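/- Let $q=2^s$ with $s\ge 1$, let $m\ge 1$, and for $n\ge 0$ let $S_n=\mathbb{F}_q[y_1,\dots,y_n,x_n,\dots,x_1]$; write $S=S_m$. Put $\overline{\xi}_0=\sum_{j=1}^m x_jy_j\in S$ and $\xi_0=z^2+\overline{\xi}_0\in S[z]$, and let $O_{2m+1}(q)$ be the subgroup of $GL_{2m+1}(q)$ fixing $\xi_0$, where $GL_{2m+1}(q)$ acts on $S[z]$ by linear substitutions of the variables $y_1,\dots,y_m,z,x_m,\dots,x_1$. For $i\ge 1$ let $\xi_i=\sum_j (x_jy_j^{q^i}+y_jx_j^{q^i})$ (in each $S_n$). Let $d_{1,m}\in S$ be the first Dickson invariant of $GL_{2m}(q)$, i.e. the coefficient of $t^{q^{2m-1}-1}$ in $\prod_v (t-v)$, the product being over all nonzero $\mathbb{F}_q$-linear forms $v$ in the variables of $S$. Let $u_n\in S_n$ be the product, over the variables $v$ of $S_n$, of the orbit products $N(v)=\prod_{c}\bigl(v+\sum_{w} c_w w\bigr)$, where $w$ runs over the variables preceding $v$ in the order $y_1,\dots,y_n,x_n,\dots,x_1$ and $c$ over all families of elements $c_w\in\mathbb{F}_q$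 (so $u_0=1$). The element $u_{m-1}\in S_{m-1}$ is a polynomial in $\xi_1,\dots,\xi_{2m-3}\in S_{m-1}$; substituting the elements $\xi_1,\dots,\xi_{2m-3}$ of $S_m$ in this polynomial gives a well-defined element of $S_m$, again denoted $u_{m-1}$. A natural monomial is a monomial in the $\xi_i$ ($i\ge 1$) all of whose exponents have only the digits $0$ and $1$ in base $q$; it is thus a product of distinct factors $\xi_a^{q^b}$ (its natural factors), whose number is its natural degree, and its degree is the sum of the $q^b(q^a+1)$ over these factors. Let $\delta_{jk}\in S$ be the sum of the natural monomials in $\xi_1,\dots,\xi_{2m-2}$ of degree $q+q^2+\cdots+q^{2m-2}-q^j-q^k$ and natural degree $m-2$, and let $\delta_1=\sum_{0<j<k<2m-1}\xi_j\xi_k\delta_{jk}$. Then there is a unique $b_1\in S$ with $$b_1^2=d_{1,m}+u_m^{q-2}\bigl(\delta_1+\overline{\xi}_0u_{m-1}^q\bigr),$$ and the element $e_1=u_m^{q/2-1}u_{m-1}^{q/2}z+b_1$ lies in the invariant ring $S[z]^{O_{2m+1}(q)}$. Its leading term, for the lexicographic as well as for the graded reverse lexicographic order with $y_1>\cdots>y_m>z>x_m>\cdots>x_1$,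 is $y_1^{q^{2m-1}(q-1)/2}$. -/

import Mathlib

noncomputable section

open MvPolynomial

namespace OddOrth

variable (F : Type*) [Field F] [Fintype F]

/-- The polynomial ring `S_m = F[y₁,…,y_m,x_m,…,x₁]`; the variable `y_{i+1}` is indexed by
`Sum.inl i` and `x_{i+1}` by `Sum.inr i`. -/
abbrev S (m : ℕ) : Type _ := MvPolynomial (Fin m ⊕ Fin m) F

/-- The polynomial ring `S_m[z]`, on the ordered basis `[y₁,…,y_m,z,x_m,…,x₁]` of `V*`. -/
abbrev Sz (m : ℕ) : Type _ := MvPolynomial (Fin (2 * m + 1)) F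

/-- The position of a variable of `S_m` in the ordered basis `[y₁,…,y_m,z,x_m,…,x₁]`. -/
def pos {m : ℕ} : Fin m ⊕ Fin m → Fin (2 * m + 1)
  | Sum.inl i => ⟨i, by omega⟩
  | Sum.inr i => ⟨2 * m - i, by omega⟩

/-- The position of `z` in the ordered basis. -/
def zpos (m : ℕ) : Fin (2 * m + 1) := ⟨m, by omega⟩

/-- The inclusion `S_m ⊆ S_m[z]`. -/
def incl (m : ℕ) : S F m →ₐ[F] Sz F m := rename pos

/-- `y_{i+1}` as an element of `S_m`. -/
def y {m : ℕ} (i : Fin m) : S F m := X (Sum.inl i)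

/-- `x_{i+1}` as an element of `S_m`. -/
def x {m : ℕ} (i : Fin m) : S F m := X (Sum.inr i)

/-- `ξ̄₀ = x₁y₁ + ⋯ + x_m y_m`. -/
def xiBar0 (m : ℕ) : S F m := ∑ j, x F j * y F j

/-- The quadratic form `ξ₀ = z² + x₁y₁ + ⋯ + x_m y_m`. -/
def xi0 (m : ℕ) : Sz F m := X (zpos m) ^ 2 + incl F m (xiBar0 F m)

/-- `ξ_i = ∑_j (x_j y_j^{q^i} + y_j x_j^{q^i})`, for `i ≥ 1`. -/
def xi (m i : ℕ) : S F m :=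
  ∑ j, (x F j * y F j ^ Fintype.card F ^ i + y F j * x F j ^ Fintype.card F ^ i)

/-! ### The orthogonal group and its invariants -/

variable {F} in
/-- The action of `g ∈ GL_{2m+1}(F)` on `S[z]`: substitution of `g • v` for the vector `v`. -/
def act {m : ℕ} (g : GL (Fin (2 * m + 1)) F) : Sz F m →ₐ[F] Sz F m :=
  aeval fun j => ∑ i, C ((g : Matrix _ _ F) j i) * X i

theorem act_one (F : Type*) [Field F] {m : ℕ} (f : Sz F m) : act (1 : GL (Fin (2 * m + 1)) F) f = f := by
  have h : act (1 : GL (Fin (2 * m + 1)) F) = AlgHom.id F (Sz F m) := by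
    ext1 j
    simp [act, Matrix.one_apply]
  rw [h]; rfl

theorem act_mul (F : Type*) [Field F] {m : ℕ} (g h : GL (Fin (2 * m + 1)) F) (f : Sz F m) :
    act (g * h) f = act h (act g f) := by
  have H : act (g * h) = (act h).comp (act g) := by
    ext1 j
    simp only [act, aeval_X, AlgHom.comp_apply, map_sum, map_mul, algHom_C, algebraMap_eq,
      Units.val_mul, Matrix.mul_apply, Finset.sum_mul, Finset.mul_sum, mul_assoc]
    exact Finset.sum_comm
  rw [H]; rfl

/-- `O_{2m+1}(q)`: the subgroup of `GL_{2m+1}(q)` fixing `ξ₀`. -/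
def orthogonalGroup (m : ℕ) : Subgroup (GL (Fin (2 * m + 1)) F) where
  carrier := {g | act g (xi0 F m) = xi0 F m}
  one_mem' := act_one F _
  mul_mem' {g h} hg hh := by
    simp only [Set.mem_ofPred_eq] at *
    rw [act_mul, hg, hh]
  inv_mem' {g} hg := by
    simp only [Set.mem_ofPred_eq] at *
    have h := act_mul F g g⁻¹ (xi0 F m)
    rw [mul_inv_cancel, act_one, hg] at h
    exact h.symm

/-- The invariant ring `S[z]^{O_{2m+1}(q)}`. -/
def invariantRing (m : ℕ) : Subalgebra F (Sz F m) where
  carrier := {f | ∀ g ∈ orthogonalGroup F m, act g f = f}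
  mul_mem' ha hb g hg := by rw [map_mul, ha g hg, hb g hg]
  add_mem' ha hb g hg := by rw [map_add, ha g hg, hb g hg]
  algebraMap_mem' r g _ := (act g).commutes r

/-! ### Dickson invariants -/

/-- The orbit product `N(v)` of a variable `v` of `S_m` over the unipotent upper triangular
group: the product of all `v + ∑_{w before v} c_w w`, the variables being ordered as
`y₁,…,y_m,x_m,…,x₁`. -/
def orbitProd {m : ℕ} (v : Fin m ⊕ Fin m) : S F m :=
  ∏ c : {w : Fin m ⊕ Fin m // pos w < pos v} → F, (X v + ∑ w, C (c w) * X w.1)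

/-- `u_m = ∏_i N(y_i) N(x_i)`. -/
def u (m : ℕ) : S F m := ∏ v, orbitProd F v

open Classical in
/-- The product of `t - v` over the nonzero linear forms `v` of `S_m`, which are the
`GL_{2m}(q)`-orbit of `x₁`. -/
def dicksonPoly (m : ℕ) : Polynomial (S F m) :=
  ∏ c ∈ Finset.univ.filter (fun c : Fin m ⊕ Fin m → F => c ≠ 0),
    (Polynomial.X - Polynomial.C (∑ v, C (c v) * X v))

/-- The Dickson invariant `d_{i,m}` of `GL_{2m}(q)`: the coefficient of `t^{q^{2m-i}-1}` in
the product of all `t - v`. -/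
def dickson (i m : ℕ) : S F m := (dicksonPoly F m).coeff (Fintype.card F ^ (2 * m - i) - 1)

/-- `w` is the element `u_{m-1}` read in `S_m`: `u_{m-1} ∈ S_{m-1}` is a polynomial in
`ξ₁,…,ξ_{2m-3}`, and `w` is the same polynomial in the elements `ξ₁,…,ξ_{2m-3}` of `S_m`. -/
def IsUPrev (m : ℕ) (w : S F m) : Prop :=
  ∃ P : MvPolynomial (Fin (2 * m - 3)) F,
    aeval (fun k : Fin (2 * m - 3) => xi F (m - 1) (k.val + 1)) P = u F (m - 1) ∧
    aeval (fun k : Fin (2 * m - 3) => xi F m (k.val + 1)) P = w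

/-! ### Natural monomials and `δ₁` -/

/-- The sum, in `S_m`, of the natural monomials in `ξ₁,…,ξ_r` of degree `D` and natural degree
`k`. A natural monomial has exponents with base `q` digits `0` and `1` only, so it is the product
of the `ξ_a^{q^b}` over a unique finite set `T` of pairs `(a, b)`, its natural factors; these have
degree `q^b (q^a + 1)`, and the natural degree is the size of `T`. (The bound `b < D` loses
nothing, since `b < q^b < D`.) -/
def naturalSum (m r D k : ℕ) : S F m :=
  ∑ T ∈ (Finset.Icc 1 r ×ˢ Finset.range D).powerset.filter (fun T =>
      ∑ p ∈ T, Fintype.card F ^ p.2 * (Fintype.card F ^ p.1 + 1) = D ∧ T.card = k),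
    ∏ p ∈ T, xi F m p.1 ^ Fintype.card F ^ p.2

/-- `δ_{jk}`: the sum of the natural monomials in `ξ₁,…,ξ_{2m-2}` of degree
`q + q² + ⋯ + q^{2m-2} - q^j - q^k` and natural degree `m - 2`. -/
def delta (m j k : ℕ) : S F m :=
  naturalSum F m (2 * m - 2)
    (∑ i ∈ Finset.Icc 1 (2 * m - 2), Fintype.card F ^ i - Fintype.card F ^ j - Fintype.card F ^ k)
    (m - 2)

/-- `δ₁ = ∑_{0<j<k<2m-1} ξ_j ξ_k δ_{jk}`. -/
def delta1 (m : ℕ) : S F m :=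
  ∑ k ∈ Finset.Icc 1 (2 * m - 2), ∑ j ∈ Finset.Ico 1 k, xi F m j * xi F m k * delta F m j k

/-! ### The element `e₁` -/

variable {F} in
/-- `b² = d_{1,m} + u_m^{q-2} (δ₁ + ξ̄₀ w^q)`, where `w` stands for `u_{m-1}` in `S_m`. -/
def IsB1 {m : ℕ} (w b : S F m) : Prop :=
  b ^ 2 = dickson F 1 m +
    u F m ^ (Fintype.card F - 2) * (delta1 F m + xiBar0 F m * w ^ Fintype.card F)

variable {F} in
/-- `e₁ = u_m^{q/2-1} w^{q/2} z + b`, where `w` stands for `u_{m-1}` in `S_m`. -/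
def e1 {m : ℕ} (w b : S F m) : Sz F m :=
  incl F m (u F m ^ (Fintype.card F / 2 - 1) * w ^ (Fintype.card F / 2)) * X (zpos m) +
    incl F m b

end OddOrth

/-- The graded reverse lexicographic order on monomials, with `X 0 > X 1 > ⋯`. -/
def GrevlexLT {n : ℕ} (a b : Fin n →₀ ℕ) : Prop :=
  a.degree < b.degree ∨ a.degree = b.degree ∧ ∃ i, b i < a i ∧ ∀ j, i < j → a j = b j

/-- `c · X^a` is the leading term of `f` for the graded reverse lexicographic order. -/
def IsGrevlexLeadingTerm {n : ℕ} {R : Type*} [CommSemiring R] (f : MvPolynomial (Fin n) R)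
    (a : Fin n →₀ ℕ) (c : R) : Prop :=
  c ≠ 0 ∧ f.coeff a = c ∧ ∀ b ∈ f.support, b ≠ a → GrevlexLT b a

end

/-! Let `f_a` be the vector of `q^a`-th powers of the variables of `S`, and `B` the standard
symplectic form. Then `B(f_a, f_b) = ξ_{b-a}^{q^a}` for `a < b`, and every object of the theorem
becomes a Pfaffian of this Gram matrix. In characteristic two the Pfaffian of `2m` vectors is their
determinant; for `f_0, …, f_{2m-1}` this is a Moore determinant, equal to `u_m` (`pf_gram_range`).
Cramer's rule gives `d_{1,m} u_m = Pf(0, …, 2m-2, 2m)` (`dickson_mul_u`). Natural monomials of the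
prescribed degree and natural degree are perfect matchings, so `δ_{jk}` is the Pfaffian on `{1, …,
2m-2} ∖ {j, k}` (`delta_eq_pf`). The element `u_{m-1}` of `S_m` is `Pf(0, …, 2m-3)`, independently
of the chosen polynomial because the `ξ_i` involved are algebraically independent in `S_{m-1}`
(`isUPrev_iff`).

Over a finite field of characteristic two, a polynomial is a square as soon as all its partial
derivatives vanish. A Pfaffian avoiding the index `0` is a `q`-th power and has zero derivative, so
derivatives act through index `0` only and are given by the functionals `pfFun`. A linear relation
between three of these (`pfFun_relation`) yields the derivative of `d_{1,m}`, which equals that of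
the correction term; hence `b₁` exists, and it is unique since squaring is injective.

The rest is read off `e₁² = d_{1,m} + u_m^{q-2}(δ₁ + ξ₀ u_{m-1}^q)` (`e1_sq`). All terms on the
right are invariant, since each `ξ_i` comes from polarizing `ξ₀`; so `e₁` is invariant. Moreover
`e₁` is homogeneous and takes the value `1` at the point `y₁ = 1` with all other coordinates zero,
so the pure power of the largest variable occurs with coefficient `1`, and it leads in both orders.
-/

noncomputable section

open MvPolynomial

namespace OddOrth

/-! ### Pfaffians in characteristic two -/

section Pfaffian

variable {R : Type*} [CommRing R]

/-- The sum over the perfect matchings of `I` of the products of the brackets `br a b` of the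
matched pairs. For a symmetric bracket with zero diagonal in characteristic two, this is the
Pfaffian. -/
def pf (br : ℕ → ℕ → R) (I : Finset ℕ) : R :=
  if h : I.Nonempty then
    ∑ j ∈ (I.erase (I.min' h)).attach,
      br (I.min' h) j.1 * pf br ((I.erase (I.min' h)).erase j.1)
  else 1
termination_by I.card
decreasing_by
  have h1 := Finset.card_erase_lt_of_mem j.2
  have h2 := Finset.card_erase_lt_of_mem (I.min'_mem h)
  omega

@[simp] theorem pf_empty (br : ℕ → ℕ → R) : pf br ∅ = 1 := by
  rw [pf, dif_neg (by simp)]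

theorem pf_min (br : ℕ → ℕ → R) {I : Finset ℕ} (h : I.Nonempty) :
    pf br I = ∑ j ∈ I.erase (I.min' h), br (I.min' h) j * pf br ((I.erase (I.min' h)).erase j) := by
  rw [pf, dif_pos h]
  exact Finset.sum_attach (I.erase (I.min' h))
    (fun j => br (I.min' h) j * pf br ((I.erase (I.min' h)).erase j))

theorem card_erase_erase_lt {I : Finset ℕ} {i j : ℕ} (hi : i ∈ I) :
    ((I.erase i).erase j).card < I.card :=
  (Finset.card_le_card (Finset.erase_subset _ _)).trans_lt (Finset.card_erase_lt_of_mem hi)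

/-- Expansion of the Pfaffian along an arbitrary element. -/
theorem pf_expand {br : ℕ → ℕ → R} (hs : ∀ a b, br a b = br b a) {I : Finset ℕ} {i : ℕ}
    (hi : i ∈ I) :
    pf br I = ∑ j ∈ I.erase i, br i j * pf br ((I.erase i).erase j) := by
  induction hn : I.card using Nat.strong_induction_on generalizing I i with
  | _ n ih =>
  have hne : I.Nonempty := ⟨i, hi⟩
  set a := I.min' hne with ha
  have haI : a ∈ I := I.min'_mem hne
  rw [pf_min br hne, ← ha]
  by_cases hia : i = a
  · rw [hia]
  have hiI : i ∈ I.erase a := Finset.mem_erase.2 ⟨hia, hi⟩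
  have haI' : a ∈ I.erase i := Finset.mem_erase.2 ⟨Ne.symm hia, haI⟩
  -- Matchings that pair `a` with `i` contribute the same term to both sides; the others give double
  -- sums over the distinct partners of `a` and of `i`.
  rw [← Finset.add_sum_erase _ _ hiI, ← Finset.add_sum_erase _ _ haI', hs a i,
    Finset.erase_right_comm (a := a) (b := i)]
  congr 1
  have e1 : ∀ j ∈ (I.erase i).erase a, br a j * pf br ((I.erase a).erase j) =
      ∑ k ∈ ((I.erase i).erase a).erase j,
        br a j * (br i k * pf br ((((I.erase i).erase a).erase j).erase k)) := by
    intro j hj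
    simp only [Finset.mem_erase] at hj
    rw [ih _ (hn ▸ card_erase_erase_lt haI) (i := i) (by simp [hi, hia, Ne.symm hj.2.1]) rfl,
      Finset.mul_sum]
    rw [Finset.erase_right_comm (a := j) (b := i), Finset.erase_right_comm (a := a) (b := i)]
  have e2 : ∀ j ∈ (I.erase i).erase a, br i j * pf br ((I.erase i).erase j) =
      ∑ k ∈ ((I.erase i).erase a).erase j,
        br i j * (br a k * pf br ((((I.erase i).erase a).erase j).erase k)) := by
    intro j hj
    simp only [Finset.mem_erase] at hj
    rw [ih _ (hn ▸ card_erase_erase_lt hi) (i := a)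
      (by simp [haI, Ne.symm hia, Ne.symm hj.1]) rfl, Finset.mul_sum]
    rw [Finset.erase_right_comm (a := j) (b := a)]
  rw [Finset.sum_congr rfl e1, Finset.sum_congr rfl e2]
  rw [Finset.sum_comm' (t' := (I.erase i).erase a) (s' := fun k => ((I.erase i).erase a).erase k)]
  · refine Finset.sum_congr rfl fun k _ => Finset.sum_congr rfl fun j _ => ?_
    rw [Finset.erase_right_comm (a := j) (b := k)]
    ring
  · intro j k
    simp only [Finset.mem_erase]
    tauto

theorem map_pf {R' : Type*} [CommRing R'] (φ : R →+* R') (br : ℕ → ℕ → R) (I : Finset ℕ) :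
    φ (pf br I) = pf (fun a b => φ (br a b)) I := by
  induction hn : I.card using Nat.strong_induction_on generalizing I with
  | _ n ih =>
  by_cases h : I.Nonempty
  · rw [pf_min _ h, pf_min _ h, map_sum]
    refine Finset.sum_congr rfl fun j _ => ?_
    rw [map_mul, ih _ (hn ▸ card_erase_erase_lt (I.min'_mem h)) _ rfl]
  · rw [Finset.not_nonempty_iff_eq_empty.1 h]
    simp

theorem pf_congr {br br' : ℕ → ℕ → R} {I : Finset ℕ}
    (h : ∀ a ∈ I, ∀ b ∈ I, a ≠ b → br a b = br' a b) : pf br I = pf br' I := by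
  induction hn : I.card using Nat.strong_induction_on generalizing I with
  | _ n ih =>
  by_cases hI : I.Nonempty
  · rw [pf_min _ hI, pf_min _ hI]
    refine Finset.sum_congr rfl fun j hj => ?_
    rw [Finset.mem_erase] at hj
    rw [ih _ (hn ▸ card_erase_erase_lt (I.min'_mem hI)) _ rfl,
      h _ (I.min'_mem hI) _ hj.2 (Ne.symm hj.1)]
    intro a ha b hb
    simp only [Finset.mem_erase] at ha hb
    exact h a ha.2.2 b hb.2.2
  · rw [Finset.not_nonempty_iff_eq_empty.1 hI]
    simp

theorem pf_map {br : ℕ → ℕ → R} (hs : ∀ a b, br a b = br b a) (e : ℕ ↪ ℕ) (I : Finset ℕ) :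
    pf br (I.map e) = pf (fun a b => br (e a) (e b)) I := by
  induction hn : I.card using Nat.strong_induction_on generalizing I with
  | _ n ih =>
  obtain rfl | ⟨i, hi⟩ := I.eq_empty_or_nonempty
  · simp
  rw [pf_expand hs (Finset.mem_map_of_mem e hi), pf_expand (fun a b => hs _ _) hi,
    ← Finset.map_erase, Finset.sum_map]
  refine Finset.sum_congr rfl fun j _ => ?_
  rw [← Finset.map_erase, ih _ (hn ▸ card_erase_erase_lt hi) _ rfl]

theorem pf_mem {A : Type*} [SetLike A R] [SubringClass A R] (s : A) {br : ℕ → ℕ → R}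
    {I : Finset ℕ} (h : ∀ a ∈ I, ∀ b ∈ I, a ≠ b → br a b ∈ s) : pf br I ∈ s := by
  induction hn : I.card using Nat.strong_induction_on generalizing I with
  | _ n ih =>
  by_cases hI : I.Nonempty
  · rw [pf_min _ hI]
    refine sum_mem fun j hj => ?_
    rw [Finset.mem_erase] at hj
    refine mul_mem (h _ (I.min'_mem hI) _ hj.2 (Ne.symm hj.1))
      (ih _ (hn ▸ card_erase_erase_lt (I.min'_mem hI)) ?_ rfl)
    intro a ha b hb
    simp only [Finset.mem_erase] at ha hb
    exact h a ha.2.2 b hb.2.2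
  · rw [Finset.not_nonempty_iff_eq_empty.1 hI, pf_empty]
    exact one_mem s

/-- In characteristic two, a symmetric function sums to zero off the diagonal. -/
theorem sum_erase_symm_eq_zero [CharP R 2] (I : Finset ℕ) (g : ℕ → ℕ → R)
    (hg : ∀ a b, g a b = g b a) : ∑ a ∈ I, ∑ b ∈ I.erase a, g a b = 0 := by
  rw [Finset.sum_sigma']
  refine Finset.sum_involution (fun p _ => ⟨p.2, p.1⟩) ?_ ?_ ?_ ?_
  · rintro ⟨a, b⟩ _
    simp only [hg b a]
    exact CharTwo.add_self_eq_zero _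
  · rintro ⟨a, b⟩ h _ heq
    simp only [Finset.mem_sigma, Finset.mem_erase] at h
    exact h.2.1 (by simpa using congrArg Sigma.fst heq)
  · rintro ⟨a, b⟩ h
    simp only [Finset.mem_sigma, Finset.mem_erase] at h ⊢
    exact ⟨h.2.2, h.2.1.symm, h.1⟩
  · rintro ⟨a, b⟩ _
    rfl

/-- Expanding each Pfaffian along `i` gives a double sum symmetric in the two partners of `i`, which
cancels in characteristic two. It says that a repeated vector makes the Pfaffian vanish. -/
theorem pf_orth [CharP R 2] {br : ℕ → ℕ → R} (hs : ∀ a b, br a b = br b a)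
    (h0 : ∀ a, br a a = 0) {I : Finset ℕ} {i : ℕ} (hi : i ∈ I) :
    ∑ j ∈ I, br i j * pf br (I.erase j) = 0 := by
  rw [← Finset.add_sum_erase _ _ hi, h0, zero_mul, zero_add]
  have : ∀ j ∈ I.erase i, br i j * pf br (I.erase j) =
      ∑ l ∈ (I.erase i).erase j, br i j * br i l * pf br (((I.erase i).erase j).erase l) := by
    intro j hj
    rw [Finset.mem_erase] at hj
    rw [pf_expand hs (i := i) (by simp [hi, Ne.symm hj.1]), Finset.mul_sum,
      Finset.erase_right_comm (a := j) (b := i)]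
    simp only [mul_assoc]
  rw [Finset.sum_congr rfl this]
  refine sum_erase_symm_eq_zero _ _ fun a b => ?_
  rw [Finset.erase_right_comm (a := a) (b := b), mul_comm (br i a)]

theorem pf_insert {br : ℕ → ℕ → R} (hs : ∀ a b, br a b = br b a) {I : Finset ℕ} {i : ℕ}
    (hi : i ∉ I) : pf br (insert i I) = ∑ j ∈ I, br i j * pf br (I.erase j) := by
  rw [pf_expand hs (Finset.mem_insert_self i I), Finset.erase_insert hi]

end Pfaffian

/-! ### The symplectic form and determinants -/

section Symplectic

variable {R : Type*} [CommRing R] {m : ℕ}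

/-- The standard alternating form in characteristic two. -/
def symp (a b : Fin m ⊕ Fin m → R) : R :=
  ∑ j, (a (Sum.inr j) * b (Sum.inl j) + a (Sum.inl j) * b (Sum.inr j))

theorem symp_comm (a b : Fin m ⊕ Fin m → R) : symp a b = symp b a :=
  Finset.sum_congr rfl fun _ _ => by ring

theorem symp_self [CharP R 2] (a : Fin m ⊕ Fin m → R) : symp a a = 0 :=
  Finset.sum_eq_zero fun j _ => by
    rw [mul_comm (a (Sum.inr j))]
    exact CharTwo.add_self_eq_zero _

theorem symp_add_left (a a' b : Fin m ⊕ Fin m → R) : symp (a + a') b = symp a b + symp a' b := by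
  simp only [symp, ← Finset.sum_add_distrib, Pi.add_apply]
  exact Finset.sum_congr rfl fun _ _ => by ring

theorem symp_smul_left (c : R) (a b : Fin m ⊕ Fin m → R) : symp (c • a) b = c * symp a b := by
  simp only [symp, Finset.mul_sum, Pi.smul_apply, smul_eq_mul]
  exact Finset.sum_congr rfl fun _ _ => by ring

/-- The linear functional which sends `ω` to the Pfaffian of the family obtained by adding `ω`
to the vectors `f j`, `j ∈ I`. -/
def pfFun (f : ℕ → Fin m ⊕ Fin m → R) (I : Finset ℕ) : (Fin m ⊕ Fin m → R) →ₗ[R] R where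
  toFun ω := ∑ j ∈ I, symp ω (f j) * pf (fun a b => symp (f a) (f b)) (I.erase j)
  map_add' a b := by simp only [symp_add_left, add_mul, Finset.sum_add_distrib]
  map_smul' c a := by
    simp only [symp_smul_left, mul_assoc, Finset.mul_sum, RingHom.id_apply, smul_eq_mul]

theorem pfFun_apply (f : ℕ → Fin m ⊕ Fin m → R) (I : Finset ℕ) (ω : Fin m ⊕ Fin m → R) :
    pfFun f I ω = ∑ j ∈ I, symp ω (f j) * pf (fun a b => symp (f a) (f b)) (I.erase j) := rfl

theorem pfFun_mem [CharP R 2] (f : ℕ → Fin m ⊕ Fin m → R) {I : Finset ℕ} {i : ℕ} (hi : i ∈ I) :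
    pfFun f I (f i) = 0 :=
  pf_orth (br := fun a b => symp (f a) (f b)) (fun _ _ => symp_comm _ _) (fun _ => symp_self _) hi

theorem pfFun_notMem (f : ℕ → Fin m ⊕ Fin m → R) {I : Finset ℕ} {i : ℕ} (hi : i ∉ I) :
    pfFun f I (f i) = pf (fun a b => symp (f a) (f b)) (insert i I) :=
  (pf_insert (br := fun a b => symp (f a) (f b)) (fun _ _ => symp_comm _ _) hi).symm

/-- The variables in the order `y₁,…,y_m,x_m,…,x₁`. -/
def ordVar (m : ℕ) : Fin (2 * m) ≃ Fin m ⊕ Fin m where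
  toFun i := if h : i.1 < m then Sum.inl ⟨i, h⟩ else Sum.inr ⟨2 * m - 1 - i, by omega⟩
  invFun v := match v with
    | Sum.inl i => ⟨i, by omega⟩
    | Sum.inr i => ⟨2 * m - 1 - i, by omega⟩
  left_inv i := by
    by_cases h : i.1 < m
    · simp [h]
    · simp only [h, dite_false, Fin.ext_iff]
      omega
  right_inv v := by
    rcases v with i | i
    · simp
    · have h : ¬ (2 * m - 1 - i.1 < m) := by omega
      simp only [h, dite_false, Sum.inr.injEq, Fin.ext_iff]
      omega

/-- Extension by zero of a finite family of vectors. -/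
def extZero {V : Type*} [Zero V] {n : ℕ} (v : Fin n → V) (i : ℕ) : V :=
  if h : i < n then v ⟨i, h⟩ else 0

theorem extZero_val {V : Type*} [Zero V] {n : ℕ} (v : Fin n → V) (i : Fin n) :
    extZero v i = v i := by simp [extZero]

theorem extZero_update_ne {V : Type*} [Zero V] {n : ℕ} (v : Fin n → V) (i : Fin n) (x : V) {j : ℕ}
    (h : j ≠ i) : extZero (Function.update v i x) j = extZero v j := by
  unfold extZero
  split_ifs with hj
  · rw [Function.update_of_ne]
    simpa [Fin.ext_iff] using h
  · rfl

/-- Expanding along `i` leaves Pfaffians that no longer involve the `i`-th vector; hence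
multilinearity. -/
theorem pf_update {n : ℕ} (v : Fin n → Fin m ⊕ Fin m → R) (i : Fin n) (x : Fin m ⊕ Fin m → R) :
    pf (fun a b => symp (extZero (Function.update v i x) a) (extZero (Function.update v i x) b))
      (Finset.range n) = pfFun (extZero v) ((Finset.range n).erase i) x := by
  rw [pf_expand (fun _ _ => symp_comm _ _) (i := i) (by simp), pfFun_apply]
  refine Finset.sum_congr rfl fun j hj => ?_
  rw [Finset.mem_erase] at hj
  rw [extZero_val, Function.update_self, extZero_update_ne _ _ _ hj.1]
  congr 1
  refine pf_congr fun a ha b hb _ => ?_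
  simp only [Finset.mem_erase] at ha hb
  rw [extZero_update_ne _ _ _ ha.2.1, extZero_update_ne _ _ _ hb.2.1]

/-- The Pfaffian of the Gram matrix, as an alternating map. -/
def pfAlt (R : Type*) [CommRing R] [CharP R 2] (m n : ℕ) :
    (Fin m ⊕ Fin m → R) [⋀^Fin n]→ₗ[R] R where
  toFun v := pf (fun a b => symp (extZero v a) (extZero v b)) (Finset.range n)
  map_update_add' v i x y := by
    obtain rfl : ‹DecidableEq (Fin n)› = instDecidableEqFin n := Subsingleton.elim _ _
    simp only [pf_update, map_add]
  map_update_smul' v i c x := by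
    obtain rfl : ‹DecidableEq (Fin n)› = instDecidableEqFin n := Subsingleton.elim _ _
    simp only [pf_update, map_smul]
  map_eq_zero_of_eq' v i j h hij := by
    have := pf_update v i (v i)
    rw [Function.update_eq_self] at this
    rw [this, h, ← extZero_val v j]
    refine pfFun_mem _ ?_
    simpa [Fin.ext_iff] using Ne.symm hij

/-- Normalises the Pfaffian: the only matching that contributes is the nested one, and the induction
adds its outermost pair. The alternative `m < k` discards the values where `m - k` truncates. -/
theorem pf_antidiagonal (m k : ℕ) :
    pf (fun a b => if a + b + 1 = 2 * m then (1 : R) else 0) (Finset.Ico (m - k) (m + k)) = 1 ∨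
      m < k := by
  induction k with
  | zero => simp
  | succ k ih =>
    by_cases hk : m < k + 1
    · exact Or.inr hk
    left
    have ih := ih.resolve_right (by omega)
    rw [pf_expand (fun a b => by rw [add_comm a b]) (i := m - (k + 1)) (by simp; omega),
      Finset.sum_eq_single (m + k)]
    · rw [if_pos (by omega), one_mul]
      convert ih using 2
      ext a
      simp only [Finset.mem_erase, Finset.mem_Ico]
      omega
    · intro b _ hb
      rw [if_neg (by omega), zero_mul]
    · intro h
      exfalso
      apply h
      simp only [Finset.mem_erase, Finset.mem_Ico]
      omega

theorem symp_single (m : ℕ) (a b : Fin (2 * m)) :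
    symp (Pi.single (ordVar m a) (1 : R)) (Pi.single (ordVar m b) 1) =
      if a.1 + b.1 + 1 = 2 * m then 1 else 0 := by
  unfold symp
  by_cases ha : a.1 < m <;> by_cases hb : b.1 < m
  · rw [if_neg (by omega)]
    simp [ordVar, ha, hb, Pi.single_apply]
  · simp only [ordVar, ha, hb, Equiv.coe_fn_mk, dite_true, dite_false, Pi.single_apply]
    simp only [reduceCtorEq, if_false, Sum.inl.injEq, Sum.inr.injEq, zero_add, mul_ite,
      mul_one, mul_zero]
    rw [Finset.sum_eq_single ⟨a, ha⟩]
    · simp only [if_true, Fin.ext_iff]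
      exact if_congr (by omega) rfl rfl
    · intro j _ hj
      simp [hj]
    · simp
  · simp only [ordVar, ha, hb, Equiv.coe_fn_mk, dite_true, dite_false, Pi.single_apply]
    simp only [reduceCtorEq, if_false, Sum.inl.injEq, Sum.inr.injEq, add_zero, mul_ite,
      mul_one, mul_zero]
    rw [Finset.sum_eq_single ⟨b, hb⟩]
    · simp only [if_true, Fin.ext_iff]
      exact if_congr (by omega) rfl rfl
    · intro j _ hj
      simp [hj]
    · simp
  · rw [if_neg (by omega)]
    simp [ordVar, ha, hb, Pi.single_apply]

/-- In characteristic two, the Pfaffian of a Gram matrix is the determinant of the vectors. -/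
theorem pf_eq_det [CharP R 2] (f : ℕ → Fin m ⊕ Fin m → R) :
    pf (fun a b => symp (f a) (f b)) (Finset.range (2 * m)) =
      Matrix.det (Matrix.of fun i j : Fin (2 * m) => f i (ordVar m j)) := by
  -- An alternating map of `2m` vectors is the determinant times its value on a basis, here `1`.
  have hb := (pfAlt R m (2 * m)).eq_smul_basis_det ((Pi.basisFun R _).reindex (ordVar m).symm)
  have h1 : pfAlt R m (2 * m) ((Pi.basisFun R _).reindex (ordVar m).symm) = 1 := by
    refine Eq.trans (pf_congr (br' := fun a b => if a + b + 1 = 2 * m then (1 : R) else 0) ?_)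
      (Eq.trans ?_ ((pf_antidiagonal m m).resolve_right (by omega)))
    · intro a ha b hb _
      rw [Finset.mem_range] at ha hb
      rw [extZero, extZero, dif_pos ha, dif_pos hb]
      have := symp_single (R := R) m ⟨a, ha⟩ ⟨b, hb⟩
      simpa using this
    · rw [Nat.sub_self, two_mul, Nat.Ico_zero_eq_range]
  rw [h1, one_smul] at hb
  have hf := DFunLike.congr_fun hb (fun i : Fin (2 * m) => f i)
  rw [Module.Basis.det_apply, ← Matrix.det_transpose] at hf
  refine Eq.trans (pf_congr ?_) (hf.trans ?_)
  · intro a ha b hb _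
    rw [Finset.mem_range] at ha hb
    rw [extZero, extZero, dif_pos ha, dif_pos hb]
  · congr 1

end Symplectic

/-! ### Moore determinants -/

section Moore

variable (F : Type*) [Field F] [Fintype F]

/-- The iterated Frobenius map `x ↦ x ^ q ^ i` of an `F`-algebra. -/
def frob (R : Type*) [CommRing R] [Algebra F R] (i : ℕ) : R →ₐ[F] R :=
  FiniteField.frobeniusAlgHom F R ^ i

theorem frob_apply {R : Type*} [CommRing R] [Algebra F R] (i : ℕ) (a : R) :
    frob F R i a = a ^ Fintype.card F ^ i := by
  rw [frob, AlgHom.coe_pow, FiniteField.coe_frobeniusAlgHom, pow_iterate]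

/-- The factorisation of `X^q - X` over `F`, evaluated at `a / b` and homogenised. -/
theorem prod_add_algebraMap_mul_of_field {L : Type*} [Field L] [Algebra F L] (a b : L) :
    ∏ c : F, (a + algebraMap F L c * b) =
      a ^ Fintype.card F - b ^ (Fintype.card F - 1) * a := by
  have hq : 1 < Fintype.card F := Fintype.one_lt_card
  by_cases hb : b = 0
  · simp [hb, zero_pow (Nat.sub_ne_zero_of_lt hq)]
  have hprod : ∏ c : F, (Polynomial.X - Polynomial.C c) =
      (Polynomial.X ^ Fintype.card F - Polynomial.X : Polynomial F) := by
    have := Polynomial.prod_multiset_X_sub_C_of_monic_of_roots_card_eq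
      (p := (Polynomial.X ^ Fintype.card F - Polynomial.X : Polynomial F))
      (Polynomial.monic_X_pow_sub (by rw [Polynomial.degree_X]; exact_mod_cast hq)) ?_
    · rw [FiniteField.roots_X_pow_card_sub_X] at this
      exact this
    · rw [FiniteField.roots_X_pow_card_sub_X, FiniteField.X_pow_card_sub_X_natDegree_eq F hq]
      rfl
  have h1 := congrArg (Polynomial.aeval (a / b)) hprod
  rw [map_prod] at h1
  simp only [map_sub, Polynomial.aeval_X, Polynomial.aeval_C, map_pow] at h1
  rw [← Equiv.prod_comp (Equiv.neg F)] at h1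
  have h2 : ∀ c : F, a + algebraMap F L c * b =
      b * (a / b - algebraMap F L (Equiv.neg F c)) := by
    intro c
    rw [Equiv.neg_apply, map_neg]
    field_simp
    ring
  rw [Finset.prod_congr rfl fun c _ => h2 c, Finset.prod_mul_distrib, h1,
    Finset.prod_const, Finset.card_univ, mul_sub, div_pow]
  congr 1
  · field_simp
  · obtain ⟨n, hn⟩ : ∃ n, Fintype.card F = n + 1 := ⟨Fintype.card F - 1, by omega⟩
    rw [hn, pow_succ, Nat.add_sub_cancel]
    field_simp

theorem prod_add_algebraMap_mul {K : Type*} [CommRing K] [IsDomain K] [Algebra F K] (a b : K) :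
    ∏ c : F, (a + algebraMap F K c * b) =
      a ^ Fintype.card F - b ^ (Fintype.card F - 1) * a := by
  apply IsFractionRing.injective K (FractionRing K)
  have := prod_add_algebraMap_mul_of_field F (algebraMap K (FractionRing K) a)
    (algebraMap K (FractionRing K) b)
  simpa only [map_prod, map_add, map_mul, map_sub, map_pow,
    ← IsScalarTower.algebraMap_apply F K (FractionRing K)] using this

variable {F} {K : Type*} [CommRing K] [Algebra F K]

variable (F) in
/-- The product of the `t + w` over the `F`-linear combinations `w` of `v 0, …, v (k - 1)`. -/
def linProd (v : ℕ → K) (k : ℕ) : Polynomial K :=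
  ∏ c : Fin k → F, (Polynomial.X + Polynomial.C (∑ i, algebraMap F K (c i) * v i))

theorem linProd_eval (v : ℕ → K) (k : ℕ) (t : K) :
    (linProd F v k).eval t = ∏ c : Fin k → F, (t + ∑ i, algebraMap F K (c i) * v i) := by
  simp [linProd, Polynomial.eval_prod, Polynomial.eval_finsetSum]

theorem linProd_eval_eq_zero (v : ℕ → K) {j k : ℕ} (h : j < k) :
    (linProd F v k).eval (v j) = 0 := by
  rw [linProd_eval]
  refine Finset.prod_eq_zero (Finset.mem_univ (Pi.single ⟨j, h⟩ (-1))) ?_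
  rw [Finset.sum_eq_single ⟨j, h⟩]
  · simp
  · intro b _ hb
    simp [Pi.single_eq_of_ne hb]
  · simp

variable [IsDomain K]

/-- `linProd` is an additive polynomial. -/
theorem exists_linProd_eq (v : ℕ → K) (k : ℕ) : ∃ a : ℕ → K, (∀ i, k < i → a i = 0) ∧ a k = 1 ∧
    linProd F v k =
      ∑ i ∈ Finset.range (k + 1), Polynomial.C (a i) * Polynomial.X ^ Fintype.card F ^ i := by
  induction k with
  | zero =>
    refine ⟨fun i => if i = 0 then 1 else 0, fun i hi => if_neg (by omega), rfl, ?_⟩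
    simp [linProd]
  | succ k ih =>
    obtain ⟨a, ha0, ha1, ha⟩ := ih
    set β := (linProd F v k).eval (v k) with hβ
    have hcomp : ∀ c : F, (linProd F v k).comp
        (Polynomial.X + Polynomial.C (algebraMap F K c * v k)) =
        linProd F v k + algebraMap F (Polynomial K) c * Polynomial.C β := by
      intro c
      rw [hβ, ha]
      simp only [Polynomial.sum_comp, Polynomial.mul_comp, Polynomial.C_comp,
        Polynomial.pow_comp, Polynomial.X_comp, Polynomial.eval_finsetSum, Polynomial.eval_mul,
        Polynomial.eval_C, Polynomial.eval_pow, Polynomial.eval_X]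
      rw [map_sum, Finset.mul_sum, ← Finset.sum_add_distrib]
      refine Finset.sum_congr rfl fun i _ => ?_
      have : algebraMap F (Polynomial K) c = Polynomial.C (algebraMap F K c) := rfl
      rw [← frob_apply F i (Polynomial.X + _), map_add, this, Polynomial.C_mul, map_mul,
        ← this, AlgHom.commutes, frob_apply, frob_apply, map_mul, map_pow]
      ring
    -- Group the factors by the coefficient `c` of `v k`: by additivity a group is `linProd F v k +
    -- c β`, and the product over `c` is known.
    have hstep : linProd F v (k + 1) = linProd F v k ^ Fintype.card F -
        Polynomial.C β ^ (Fintype.card F - 1) * linProd F v k := by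
      rw [← prod_add_algebraMap_mul F (linProd F v k) (Polynomial.C β), linProd,
        ← Equiv.prod_comp (Fin.snocEquiv fun _ => F), Fintype.prod_prod_type]
      refine Finset.prod_congr rfl fun c _ => ?_
      rw [← hcomp, linProd, Polynomial.prod_comp]
      refine Finset.prod_congr rfl fun d _ => ?_
      simp [Fin.sum_univ_castSucc, Fin.snocEquiv, add_assoc, add_comm]
    -- The coefficients of `hstep`: the `q`-th power raises each coefficient to the power `q` and
    -- shifts its index by one.
    refine ⟨fun i => (if i = 0 then 0 else a (i - 1) ^ Fintype.card F) -
      β ^ (Fintype.card F - 1) * a i, ?_, ?_, ?_⟩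
    · intro i hi
      simp only
      rw [if_neg (by omega), ha0 _ (by omega), ha0 _ (by omega),
        zero_pow Fintype.card_ne_zero, mul_zero, sub_zero]
    · simp [ha1, ha0 (k + 1) (by omega)]
    · rw [hstep]
      simp only [map_sub, sub_mul, Finset.sum_sub_distrib]
      congr 1
      · rw [Finset.sum_range_succ', if_pos rfl, map_zero, zero_mul, add_zero, ha]
        rw [← FiniteField.frobeniusAlgHom_apply F, map_sum]
        refine Finset.sum_congr rfl fun i _ => ?_
        simp only [FiniteField.frobeniusAlgHom_apply, mul_pow, Nat.add_sub_cancel, ← pow_mul, pow_succ (Fintype.card F) i]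
        simp
      · rw [Finset.sum_range_succ, ha0 (k + 1) (by omega), ha, Finset.mul_sum]
        simp [mul_assoc]

/-- Multiplying by the unitriangular matrix of the coefficients of the polynomials `linProd F v k`
turns the Moore matrix into the matrix of their values at the `v j`, which is triangular since
`linProd F v k` vanishes at `v j` for `j < k`. -/
theorem det_moore (v : ℕ → K) (n : ℕ) :
    Matrix.det (Matrix.of fun i j : Fin n => v j ^ Fintype.card F ^ i.1) =
      ∏ k : Fin n, (linProd F v k).eval (v k) := by
  choose a ha0 ha1 ha using exists_linProd_eq (F := F) v
  let A : Matrix (Fin n) (Fin n) K := Matrix.of fun k i => a k i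
  let M : Matrix (Fin n) (Fin n) K := Matrix.of fun i j => v j ^ Fintype.card F ^ i.1
  have hA : A.det = 1 := by
    rw [Matrix.det_of_isLowerTriangular A fun i j hij => ha0 _ _ hij]
    exact Finset.prod_eq_one fun i _ => ha1 _
  have hAM : ∀ k j, (A * M) k j = (linProd F v k).eval (v j) := by
    intro k j
    rw [Matrix.mul_apply, ha]
    simp only [Polynomial.eval_finsetSum, Polynomial.eval_mul, Polynomial.eval_C,
      Polynomial.eval_pow, Polynomial.eval_X]
    rw [← Fin.sum_univ_eq_sum_range (fun i => a k i * v j ^ Fintype.card F ^ i) n |>.trans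
      (Finset.sum_subset (s₁ := Finset.range (k.1 + 1)) (s₂ := Finset.range n) ?_ ?_).symm]
    · rfl
    · intro i hi
      simp only [Finset.mem_range] at *
      omega
    · intro i _ hi
      rw [ha0 _ _ (by simpa using hi), zero_mul]
  have h : (A * M).det = ∏ k : Fin n, (linProd F v k).eval (v k) := by
    rw [Matrix.det_of_isUpperTriangular fun k j hjk => ?_]
    · exact Finset.prod_congr rfl fun k _ => hAM k k
    · rw [hAM]
      exact linProd_eval_eq_zero v hjk
  rw [← h, Matrix.det_mul, hA, one_mul]

end Moore

/-! ### The Gram matrix of the Frobenius powers of the generic vector -/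

section Gram

variable (F : Type*) [Field F] [Fintype F]

/-- The image of the generic vector under the `a`-th power of the Frobenius map. -/
def frobVec (m a : ℕ) : Fin m ⊕ Fin m → S F m := fun s => X s ^ Fintype.card F ^ a

/-- The values of the symplectic form on the vectors `frobVec`. -/
def gram (m a b : ℕ) : S F m := symp (frobVec F m a) (frobVec F m b)

variable {F}

theorem gram_comm {m : ℕ} (a b : ℕ) : gram F m a b = gram F m b a := symp_comm _ _

theorem xi_eq_gram (m i : ℕ) : xi F m i = gram F m 0 i := by
  simp [xi, gram, symp, frobVec, x, y]

theorem gram_add (m a b c : ℕ) :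
    gram F m (a + c) (b + c) = gram F m a b ^ Fintype.card F ^ c := by
  rw [← frob_apply F]
  simp only [gram, symp, frobVec, map_sum, map_add, map_mul, frob_apply, ← pow_mul, pow_add]

theorem gram_eq_xi {m a b : ℕ} (h : a < b) :
    gram F m a b = xi F m (b - a) ^ Fintype.card F ^ a := by
  rw [xi_eq_gram, ← gram_add, zero_add, Nat.sub_add_cancel h.le]

/-- A polynomial expression in the `ξ_i` is in every subring closed under these. -/
theorem gram_mem {m : ℕ} {A : Type*} [SetLike A (S F m)] [SubringClass A (S F m)] (s : A)
    (h : ∀ i, 1 ≤ i → xi F m i ∈ s) {a b : ℕ} (hab : a ≠ b) : gram F m a b ∈ s := by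
  rcases lt_or_gt_of_ne hab with hlt | hlt
  · rw [gram_eq_xi hlt]
    exact pow_mem (h _ (by omega)) _
  · rw [gram_comm, gram_eq_xi hlt]
    exact pow_mem (h _ (by omega)) _

/-- Frobenius shifts the indices of the Gram matrix. In particular, a Pfaffian avoiding the index
`0` is a `q`-th power. -/
theorem pf_gram_map_add (m c : ℕ) (I : Finset ℕ) :
    pf (gram F m) (I.map (addRightEmbedding c)) = pf (gram F m) I ^ Fintype.card F ^ c := by
  rw [pf_map gram_comm, ← frob_apply F, ← AlgHom.coe_toRingHom, map_pf]
  refine pf_congr fun a _ b _ _ => ?_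
  rw [AlgHom.coe_toRingHom, frob_apply, ← gram_add]
  rfl

theorem pf_gram_Ico (m n : ℕ) :
    pf (gram F m) (Finset.Ico 1 (n + 1)) = pf (gram F m) (Finset.range n) ^ Fintype.card F := by
  have h := pf_gram_map_add (F := F) m 1 (Finset.range n)
  rw [pow_one] at h
  rw [← h, Finset.range_eq_Ico, Finset.map_add_right_Ico, zero_add]

/-! ### `u_m` and the Dickson invariant as Pfaffians -/

/-- The variables in the order `y₁,…,y_m,x_m,…,x₁`, followed by zeros. -/
def varSeq (F : Type*) [Field F] [Fintype F] (m : ℕ) : ℕ → S F m :=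
  extZero fun k => X (ordVar m k)

theorem pos_lt_pos_iff {m : ℕ} (v w : Fin m ⊕ Fin m) :
    pos w < pos v ↔ ((ordVar m).symm w).1 < ((ordVar m).symm v).1 := by
  rcases v with v | v <;> rcases w with w | w <;>
    simp only [pos, ordVar, Equiv.coe_fn_symm_mk, Fin.mk_lt_mk] <;> omega

/-- The variables preceding the `k`-th one. -/
def precedingEquiv (m : ℕ) (k : Fin (2 * m)) :
    Fin k ≃ {w : Fin m ⊕ Fin m // pos w < pos (ordVar m k)} where
  toFun i := ⟨ordVar m ⟨i, by omega⟩, by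
    rw [pos_lt_pos_iff]
    simp⟩
  invFun w := ⟨(ordVar m).symm w, by
    have := (pos_lt_pos_iff _ _).1 w.2
    simpa using this⟩
  left_inv i := by simp
  right_inv w := by simp

theorem orbitProd_ordVar (m : ℕ) (k : Fin (2 * m)) :
    orbitProd F (ordVar m k) = (linProd F (varSeq F m) k).eval (varSeq F m k) := by
  rw [linProd_eval, orbitProd, ← Equiv.prod_comp (Equiv.arrowCongr (precedingEquiv m k).symm
    (Equiv.refl F))]
  refine Finset.prod_congr rfl fun c _ => ?_
  rw [varSeq, extZero_val, ← Equiv.sum_comp (precedingEquiv m k)]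
  congr 1
  refine Finset.sum_congr rfl fun i _ => ?_
  have hi : i.1 < 2 * m := by omega
  simp [extZero, hi, precedingEquiv, MvPolynomial.algebraMap_eq, Equiv.arrowCongr]

theorem det_frobVec (m : ℕ) :
    Matrix.det (Matrix.of fun i j : Fin (2 * m) => frobVec F m i (ordVar m j)) = u F m := by
  have := det_moore (F := F) (varSeq F m) (2 * m)
  rw [u, ← Equiv.prod_comp (ordVar m), Finset.prod_congr rfl fun k _ => orbitProd_ordVar m k, ← this]
  simp only [varSeq, extZero_val, frobVec]

/-- Each factor of the orbit product of `v` takes the value `1` where `v = 1` and the other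
variables vanish. -/
theorem u_ne_zero (m : ℕ) : u F m ≠ 0 := by
  refine Finset.prod_ne_zero_iff.2 fun v _ => Finset.prod_ne_zero_iff.2 fun c _ h => ?_
  have := congrArg (eval (Pi.single v 1)) h
  rw [map_add, eval_X, Pi.single_eq_same, map_sum, Finset.sum_eq_zero, add_zero, map_zero] at this
  · exact one_ne_zero this
  · intro w _
    have hw : w.1 ≠ v := fun h => (lt_irrefl _ (h ▸ w.2))
    simp [Pi.single_eq_of_ne hw]

theorem X_mul_dicksonPoly [CharP F 2] (m : ℕ) :
    Polynomial.X * dicksonPoly F m = linProd F (varSeq F m) (2 * m) := by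
  classical
  have h1 : linProd F (varSeq F m) (2 * m) =
      ∏ c : Fin m ⊕ Fin m → F, (Polynomial.X - Polynomial.C (∑ v, C (c v) * X v)) := by
    rw [linProd, ← Equiv.prod_comp (Equiv.arrowCongr (ordVar m).symm (Equiv.refl F))]
    refine Finset.prod_congr rfl fun c _ => ?_
    rw [CharTwo.sub_eq_add, ← Equiv.sum_comp (ordVar m)]
    simp [varSeq, extZero_val, Equiv.arrowCongr, MvPolynomial.algebraMap_eq]
  rw [h1, ← Finset.mul_prod_erase _ _ (Finset.mem_univ 0), dicksonPoly, Finset.filter_ne']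
  simp

variable [CharP F 2]

/-- Exhibits `u_m` as a polynomial in the `ξ_i`, and gives the nonzero Pfaffian on which the linear
algebra below rests. -/
theorem pf_gram_range (m : ℕ) : pf (gram F m) (Finset.range (2 * m)) = u F m := by
  rw [← det_frobVec]
  exact pf_eq_det (frobVec F m)

/-- The Dickson invariants express `frobVec (2 * m)` by the lower powers. -/
theorem exists_frobVec_eq (m : ℕ) : ∃ a : ℕ → S F m,
    a (2 * m - 1) = dickson F 1 m ∧
      frobVec F m (2 * m) = ∑ i ∈ Finset.range (2 * m), a i • frobVec F m i := by
  obtain ⟨a, ha0, ha1, ha⟩ := exists_linProd_eq (F := F) (varSeq F m) (2 * m)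
  have hq : 1 < Fintype.card F := Fintype.one_lt_card
  refine ⟨a, ?_, ?_⟩
  · have h1 : (Polynomial.X * dicksonPoly F m).coeff (Fintype.card F ^ (2 * m - 1)) =
        a (2 * m - 1) := by
      rw [X_mul_dicksonPoly, ha, Polynomial.finsetSum_coeff]
      simp only [Polynomial.coeff_C_mul, Polynomial.coeff_X_pow]
      rw [Finset.sum_eq_single (2 * m - 1)]
      · simp
      · intro i _ hi
        rw [if_neg (fun h => hi (Nat.pow_right_injective hq h).symm), mul_zero]
      · intro h
        simp at h
    have hpos : 0 < Fintype.card F ^ (2 * m - 1) := pow_pos (by omega) _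
    rw [dickson, ← h1, ← Polynomial.coeff_X_mul (dicksonPoly F m), Nat.sub_add_cancel hpos]
  · funext s
    obtain ⟨k, rfl⟩ := (ordVar m).surjective s
    have h0 := linProd_eval_eq_zero (F := F) (varSeq F m) k.2
    rw [ha, Finset.sum_range_succ, ha1] at h0
    simp only [Polynomial.eval_add, Polynomial.eval_finsetSum, Polynomial.eval_mul,
      Polynomial.eval_C, Polynomial.eval_pow, Polynomial.eval_X, varSeq, extZero_val, one_mul] at h0
    rw [CharTwo.add_eq_zero] at h0
    rw [Finset.sum_apply]
    exact h0.symm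

/-- Cramer's rule: replace `f_{2m-1}` by `f_{2m}` in the Pfaffian of `u_m` and expand `f_{2m}` in
the lower powers; only the term in `f_{2m-1}`, whose coefficient is the Dickson invariant, is not
killed by a repetition. -/
theorem dickson_mul_u {m : ℕ} (hm : 1 ≤ m) :
    dickson F 1 m * u F m = pf (gram F m) (insert (2 * m) (Finset.range (2 * m - 1))) := by
  obtain ⟨a, ha, hf⟩ := exists_frobVec_eq (F := F) m
  have h1 := pfFun_notMem (frobVec F m) (I := Finset.range (2 * m - 1)) (i := 2 * m)
    (by simp)
  have h2 := pfFun_notMem (frobVec F m) (I := Finset.range (2 * m - 1)) (i := 2 * m - 1)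
    (by simp)
  rw [← Finset.range_add_one, Nat.sub_add_cancel (by omega)] at h2
  rw [hf, map_sum] at h1
  refine Eq.trans ?_ h1
  rw [Finset.sum_eq_single (2 * m - 1)]
  · rw [map_smul, h2, ha, smul_eq_mul, ← pf_gram_range]
    rfl
  · intro i hi hne
    rw [Finset.mem_range] at hi
    rw [map_smul, pfFun_mem _ (by rw [Finset.mem_range]; omega), smul_zero]
  · intro h
    simp at h
    omega

end Gram

/-! ### Natural monomials and perfect matchings -/

section Natural

/-- The binary expansion is the shortest way to write a number as a sum of powers of two: merging
`2^a + 2^a` into `2^(a+1)` shortens any sum with a repetition. -/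
theorem eq_val_of_sum_two_pow (A : Multiset ℕ) (I : Finset ℕ)
    (h : (A.map (2 ^ ·)).sum = ∑ i ∈ I, 2 ^ i) :
    I.card ≤ A.card ∧ (A.card = I.card → A = I.val) := by
  induction hn : A.card using Nat.strong_induction_on generalizing A with
  | _ n ih =>
  by_cases hA : A.Nodup
  · have : (⟨A, hA⟩ : Finset ℕ) = I := Finset.geomSum_injective le_rfl h
    subst this
    exact ⟨hn.le, fun _ => rfl⟩
  · rw [Multiset.nodup_iff_ne_cons_cons] at hA
    push Not at hA
    obtain ⟨a, t, rfl⟩ := hA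
    simp only [Multiset.card_cons] at hn
    have := (ih (t.card + 1) (by omega) ((a + 1) ::ₘ t) (by
      rw [← h]
      simp only [Multiset.map_cons, Multiset.sum_cons]
      ring) (by simp)).1
    exact ⟨by omega, fun h' => by omega⟩

/-- Fixing the number of powers is essential, as `q` copies of `q^a` also sum to `q^(a+1)`. This is
the role of the natural degree. -/
theorem eq_val_of_sum_pow {q s : ℕ} (hs : s ≠ 0) (hq : q = 2 ^ s) (A : Multiset ℕ) (I : Finset ℕ)
    (h : (A.map (q ^ ·)).sum = ∑ i ∈ I, q ^ i) (hc : A.card = I.card) : A = I.val := by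
  have hinj : Function.Injective (s * ·) := fun a b hab => Nat.eq_of_mul_eq_mul_left (by omega) hab
  have := (eq_val_of_sum_two_pow (A.map (s * ·)) (I.map ⟨(s * ·), hinj⟩) (by
    subst hq
    simpa [Multiset.map_map, Function.comp_def, pow_mul] using h)).2 (by simpa using hc)
  exact Multiset.map_injective hinj this

/-- The multiset of the points matched by `T`, where `(a, b)` stands for the pair
`{b, a + b}`. -/
def points (T : Finset (ℕ × ℕ)) : Multiset ℕ := ∑ p ∈ T, {p.2, p.1 + p.2}

theorem points_insert {T : Finset (ℕ × ℕ)} {p : ℕ × ℕ} (hp : p ∉ T) :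
    points (insert p T) = {p.2, p.1 + p.2} + points T := Finset.sum_insert hp

theorem mem_points {T : Finset (ℕ × ℕ)} {a : ℕ} :
    a ∈ points T ↔ ∃ p ∈ T, a = p.2 ∨ a = p.1 + p.2 := by
  simp [points, Multiset.mem_sum]

theorem card_points (T : Finset (ℕ × ℕ)) : (points T).card = 2 * T.card := by
  simp [points, mul_comm]

theorem sum_points (q : ℕ) (T : Finset (ℕ × ℕ)) :
    ((points T).map (q ^ ·)).sum = ∑ p ∈ T, q ^ p.2 * (q ^ p.1 + 1) := by
  induction T using Finset.induction_on with
  | empty => simp [points]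
  | insert p T hp ih =>
    rw [points_insert hp, Multiset.map_add, Multiset.sum_add, ih, Finset.sum_insert hp]
    simp [pow_add]
    ring

/-- The perfect matchings of `I`. -/
def matchings (N : ℕ) (I : Finset ℕ) : Finset (Finset (ℕ × ℕ)) :=
  (Finset.Icc 1 N ×ˢ Finset.range N).powerset.filter fun T => points T = I.val

theorem mem_matchings {N : ℕ} {I : Finset ℕ} (hI : I ⊆ Finset.range N) {T : Finset (ℕ × ℕ)} :
    T ∈ matchings N I ↔ (∀ p ∈ T, 1 ≤ p.1) ∧ points T = I.val := by
  rw [matchings, Finset.mem_filter, Finset.mem_powerset]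
  refine and_congr_left fun h => ⟨fun hT p hp => ?_, fun hT p hp => ?_⟩
  · have := hT hp
    simp only [Finset.mem_product, Finset.mem_Icc] at this
    exact this.1.1
  · have h1 : p.1 + p.2 ∈ I := by
      rw [← Finset.mem_val, ← h, mem_points]
      exact ⟨p, hp, Or.inr rfl⟩
    have := hI h1
    have := hT p hp
    simp only [Finset.mem_product, Finset.mem_Icc, Finset.mem_range] at *
    omega

theorem val_eq_pair_add {I : Finset ℕ} {i j : ℕ} (hi : i ∈ I) (hj : j ∈ I.erase i) :
    I.val = {i, j} + ((I.erase i).erase j).val := by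
  conv_lhs => rw [← Finset.insert_erase hi, ← Finset.insert_erase hj]
  rw [Finset.insert_val_of_notMem, Finset.insert_val_of_notMem (by simp)]
  · simp [← Multiset.singleton_add, Multiset.insert_eq_cons, add_assoc]
  · rw [Finset.insert_erase hj]
    simp

/-- Removing the pair that contains the least element `i` reproduces the recursion of `pf`; the pair
`{i, j}` is coded by `(j - i, i)`. -/
theorem sum_matchings {R : Type*} [CommRing R] (br : ℕ → ℕ → R) (N : ℕ) {I : Finset ℕ}
    (hI : I ⊆ Finset.range N) :
    ∑ T ∈ matchings N I, ∏ p ∈ T, br p.2 (p.1 + p.2) = pf br I := by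
  induction hn : I.card using Nat.strong_induction_on generalizing I with
  | _ n ih =>
  by_cases hne : I.Nonempty
  swap
  · rw [Finset.not_nonempty_iff_eq_empty] at hne
    subst hne
    have : matchings N ∅ = {∅} := by
      ext T
      rw [mem_matchings hI, Finset.mem_singleton]
      constructor
      · rintro ⟨_, h⟩
        have := card_points T
        rw [h] at this
        simpa using this.symm
      · rintro rfl
        simp [points]
    simp [this]
  set i := I.min' hne with hi
  have hiI : i ∈ I := I.min'_mem hne
  have hlt : ∀ j ∈ I.erase i, i < j := fun j hj => I.min'_lt_of_mem_erase_min' hne hj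
  have hsub : ∀ j, (I.erase i).erase j ⊆ Finset.range N := fun j =>
    (Finset.erase_subset _ _).trans ((Finset.erase_subset _ _).trans hI)
  have hnot : ∀ j j' T, T ∈ matchings N ((I.erase i).erase j) → (j', i) ∉ T := by
    intro j j' T hT hp
    have h1 : i ∈ points T := mem_points.2 ⟨_, hp, Or.inl rfl⟩
    rw [((mem_matchings (hsub j)).1 hT).2, Finset.mem_val] at h1
    simp at h1
  rw [pf_min br hne, ← hi]
  have hstep : ∀ j ∈ I.erase i, br i j * pf br ((I.erase i).erase j) =
      ∑ T ∈ matchings N ((I.erase i).erase j), br i j * ∏ p ∈ T, br p.2 (p.1 + p.2) := by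
    intro j _
    rw [← ih _ (hn ▸ card_erase_erase_lt hiI) (hsub j) rfl, Finset.mul_sum]
  rw [Finset.sum_congr rfl hstep, Finset.sum_sigma']
  symm
  refine Finset.sum_bij (fun z _ => insert (z.1 - i, i) z.2) ?_ ?_ ?_ ?_
  · rintro ⟨j, T⟩ hz
    rw [Finset.mem_sigma] at hz
    have hj := hlt j hz.1
    have hT := (mem_matchings (hsub j)).1 hz.2
    rw [mem_matchings hI]
    refine ⟨?_, ?_⟩
    · intro p hp
      rcases Finset.mem_insert.1 hp with rfl | hp
      · simp only
        omega
      · exact hT.1 p hp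
    · rw [points_insert (hnot _ _ _ hz.2), hT.2, val_eq_pair_add hiI hz.1,
        Nat.sub_add_cancel hj.le]
  · rintro ⟨j, T⟩ hz ⟨j', T'⟩ hz' heq
    rw [Finset.mem_sigma] at hz hz'
    simp only at heq hz hz'
    have h1 : (j - i, i) ∈ insert (j' - i, i) T' := heq ▸ Finset.mem_insert_self _ _
    have h2 := (Finset.mem_insert.1 h1).resolve_right (hnot _ _ _ hz'.2)
    have hj := hlt j hz.1
    have hj' := hlt j' hz'.1
    have h3 : j = j' := by
      have := congrArg Prod.fst h2
      simp only at this
      omega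
    subst h3
    have h4 := congrArg (fun T => T.erase (j - i, i)) heq
    simp only [Finset.erase_insert (hnot _ _ _ hz.2), Finset.erase_insert (hnot _ _ _ hz'.2)] at h4
    rw [h4]
  · intro T hT
    have hT := (mem_matchings hI).1 hT
    have hmem : ∀ a, a ∈ points T ↔ a ∈ I := fun a => by rw [hT.2, Finset.mem_val]
    obtain ⟨p, hp, hpi⟩ := mem_points.1 ((hmem i).2 hiI)
    have hp2 : p.2 ∈ I := (hmem _).1 (mem_points.2 ⟨p, hp, Or.inl rfl⟩)
    have hp3 : p.1 + p.2 ∈ I := (hmem _).1 (mem_points.2 ⟨p, hp, Or.inr rfl⟩)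
    have h1 := hT.1 p hp
    have h2 : i ≤ p.2 := I.min'_le _ hp2
    have h3 : i = p.2 := by omega
    have hj : p.1 + i ∈ I.erase i := by
      rw [Finset.mem_erase, h3]
      exact ⟨by omega, hp3⟩
    have hpe : (p.1 + i - i, i) = p := by
      rw [Nat.add_sub_cancel]
      exact Prod.ext rfl h3
    refine ⟨⟨p.1 + i, T.erase p⟩, ?_, ?_⟩
    · rw [Finset.mem_sigma]
      refine ⟨hj, (mem_matchings (hsub _)).2 ⟨fun p' hp' => hT.1 p' (Finset.mem_of_mem_erase hp'), ?_⟩⟩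
      have h4 := hT.2
      rw [val_eq_pair_add hiI hj, ← Finset.insert_erase hp, points_insert (by simp), ← h3] at h4
      exact add_left_cancel h4
    · simp only [hpe]
      exact Finset.insert_erase hp
  · rintro ⟨j, T⟩ hz
    rw [Finset.mem_sigma] at hz
    have hj := hlt j hz.1
    rw [Finset.prod_insert (hnot _ _ _ hz.2), Nat.sub_add_cancel hj.le]

/-- The degree of a natural monomial is the sum of `q^i` over its matched points, and twice its
natural degree is their number; together they force the points to be exactly `I`, each once. -/
theorem naturalSum_eq_pf {F : Type*} [Field F] [Fintype F] [CharP F 2] (m : ℕ) {r k : ℕ}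
    {I : Finset ℕ} (hI : I ⊆ Finset.Icc 1 r) (hk : I.card = 2 * k) :
    naturalSum F m r (∑ i ∈ I, Fintype.card F ^ i) k = pf (gram F m) I := by
  obtain ⟨s, -, hs⟩ := FiniteField.card F 2
  have hIr : I ⊆ Finset.range (r + 1) := fun i hi => by
    have := hI hi
    simp only [Finset.mem_Icc, Finset.mem_range] at *
    omega
  rw [← sum_matchings (gram F m) (r + 1) hIr, naturalSum]
  refine Finset.sum_congr ?_ fun T hT => Finset.prod_congr rfl fun p hp => ?_
  · ext T
    rw [mem_matchings hIr, Finset.mem_filter, Finset.mem_powerset]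
    constructor
    · rintro ⟨hT, hsum, hc⟩
      refine ⟨fun p hp => ?_, eq_val_of_sum_pow s.ne_zero hs _ _ ?_ ?_⟩
      · have := hT hp
        simp only [Finset.mem_product, Finset.mem_Icc] at this
        exact this.1.1
      · rw [sum_points, hsum]
      · rw [card_points, hc, hk]
    · rintro ⟨hT, hval⟩
      refine ⟨fun p hp => ?_, ?_, ?_⟩
      · have h1 : p.2 ∈ I := by
          rw [← Finset.mem_val, ← hval, mem_points]
          exact ⟨p, hp, Or.inl rfl⟩
        have h2 : p.1 + p.2 ∈ I := by
          rw [← Finset.mem_val, ← hval, mem_points]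
          exact ⟨p, hp, Or.inr rfl⟩
        have h3 := hT p hp
        have h4 := hI h2
        have h5 : p.2 < Fintype.card F ^ p.2 := Nat.lt_pow_self Fintype.one_lt_card
        have h6 : Fintype.card F ^ p.2 ≤ ∑ i ∈ I, Fintype.card F ^ i :=
          Finset.single_le_sum (f := fun i => Fintype.card F ^ i) (fun _ _ => Nat.zero_le _) h1
        simp only [Finset.mem_product, Finset.mem_Icc, Finset.mem_range] at *
        omega
      · rw [← sum_points, hval]
        rfl
      · have := card_points T
        rw [hval, Finset.card_val, hk] at this
        omega
  · rw [gram_eq_xi, Nat.add_sub_cancel]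
    have hT := Finset.mem_powerset.1 (Finset.mem_filter.1 hT).1 hp
    simp only [Finset.mem_product, Finset.mem_Icc] at hT
    omega

theorem delta_eq_pf {F : Type*} [Field F] [Fintype F] [CharP F 2] (m : ℕ) {j k : ℕ}
    (hj : j ∈ Finset.Icc 1 (2 * m - 2)) (hk : k ∈ (Finset.Icc 1 (2 * m - 2)).erase j) :
    delta F m j k = pf (gram F m) (((Finset.Icc 1 (2 * m - 2)).erase j).erase k) := by
  rw [← naturalSum_eq_pf (r := 2 * m - 2) (k := m - 2), delta]
  · congr 1
    rw [← Finset.add_sum_erase _ _ hj, ← Finset.add_sum_erase _ _ hk]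
    omega
  · exact (Finset.erase_subset _ _).trans (Finset.erase_subset _ _)
  · rw [Finset.card_erase_of_mem hk, Finset.card_erase_of_mem hj, Nat.card_Icc]
    omega

end Natural

/-! ### Squares and derivatives in characteristic two -/

section Squares

variable {F : Type*} [Field F] [Fintype F] [CharP F 2] {σ : Type*}

/-- Vanishing derivatives force all exponents to be even, every coefficient is a square in `F`, and
squaring is additive. -/
theorem exists_sq_eq_of_pderiv_eq_zero (f : MvPolynomial σ F) (h : ∀ i, pderiv i f = 0) :
    ∃ g : MvPolynomial σ F, g ^ 2 = f := by
  have hsq : ∀ c : F, ∃ r : F, r ^ 2 = c := fun c => by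
    obtain ⟨r, hr⟩ := FiniteField.isSquare_of_char_two (CharP.ringChar_of_prime_eq_zero
      Nat.prime_two (CharTwo.two_eq_zero (R := F))) c
    exact ⟨r, by rw [hr, sq]⟩
  choose r hr using hsq
  have heven : ∀ a ∈ f.support, ∀ i, 2 ∣ a i := by
    intro a ha i
    by_contra hodd
    have h1 : Finsupp.single i 1 ≤ a := by
      rw [Finsupp.single_le_iff]
      omega
    have h2 := coeff_pderiv (i := i) f (a - Finsupp.single i 1)
    rw [h i, coeff_zero, tsub_add_cancel_of_le h1] at h2
    have h3 : (((a - Finsupp.single i 1 : σ →₀ ℕ) i : ℕ) : F) + 1 = 1 := by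
      have : 2 ∣ (a - Finsupp.single i 1 : σ →₀ ℕ) i := by
        rw [Finsupp.tsub_apply, Finsupp.single_eq_same]
        omega
      rw [(CharP.cast_eq_zero_iff F 2 _).2 this, zero_add]
    rw [h3, mul_one] at h2
    exact mem_support_iff.1 ha h2.symm
  refine ⟨∑ a ∈ f.support, monomial (a.mapRange (· / 2) rfl) (r (f.coeff a)), ?_⟩
  rw [sum_pow_char 2]
  conv_rhs => rw [f.as_sum]
  refine Finset.sum_congr rfl fun a ha => ?_
  rw [monomial_pow, hr]
  congr 2
  ext i
  simpa using Nat.mul_div_cancel' (heven a ha i)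

theorem pderiv_pow_even {F : Type*} [Field F] [CharP F 2] {σ : Type*} (i : σ) (f : MvPolynomial σ F) {n : ℕ} (hn : 2 ∣ n) :
    pderiv i (f ^ n) = 0 := by
  rw [pderiv_pow, (CharP.cast_eq_zero_iff (MvPolynomial σ F) 2 n).2 hn, zero_mul, zero_mul]

theorem two_dvd_card (F : Type*) [Field F] [Fintype F] [CharP F 2] : 2 ∣ Fintype.card F := by
  obtain ⟨s, -, hs⟩ := FiniteField.card F 2
  rw [hs]
  exact dvd_pow_self 2 s.ne_zero

end Squares

/-! ### Derivatives of the Pfaffians -/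

section Derivatives

variable {F : Type*} [Field F] [Fintype F] {m : ℕ}

/-- Fills the place of index `0` in the family of derivatives: `xi F m 0` itself is zero in
characteristic two. -/
theorem pderiv_xiBar0 (s : Fin m ⊕ Fin m) :
    pderiv s (xiBar0 F m) = symp (Pi.single s 1) (frobVec F m 0) := by
  simp only [xiBar0, symp, frobVec, x, y, map_sum, pderiv_mul, pderiv_X, pow_zero, pow_one]
  refine Finset.sum_congr rfl fun j _ => ?_
  rw [mul_comm (X (Sum.inr j))]

/-- The determinant of these vectors is `u_m ≠ 0` in a domain, so they span over the fraction field.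
-/
theorem eq_zero_of_frobVec (L : (Fin m ⊕ Fin m → S F m) →ₗ[S F m] S F m)
    (h : ∀ k < 2 * m, L (frobVec F m k) = 0) : L = 0 := by
  have hdet : Matrix.det (Matrix.of fun i j : Fin (2 * m) => frobVec F m i (ordVar m j)) ≠ 0 := by
    rw [det_frobVec]
    exact u_ne_zero m
  have h0 := Matrix.eq_zero_of_mulVec_eq_zero hdet
    (v := fun j => L (Pi.single (ordVar m j) 1)) (by
      funext k
      have := h k k.2
      rw [LinearMap.pi_apply_eq_sum_univ, ← Equiv.sum_comp (ordVar m)] at this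
      rw [Matrix.mulVec, dotProduct, Pi.zero_apply, ← this]
      refine Finset.sum_congr rfl fun j _ => ?_
      rw [smul_eq_mul, Matrix.of_apply]
      congr 2
      funext a
      rw [Pi.single_apply]
      simp only [eq_comm])
  refine LinearMap.pi_ext' fun s => LinearMap.ext_ring ?_
  obtain ⟨j, rfl⟩ := (ordVar m).surjective s
  exact congrFun h0 j

variable [CharP F 2]

theorem pderiv_xi {i : ℕ} (hi : 1 ≤ i) (s : Fin m ⊕ Fin m) :
    pderiv s (xi F m i) = symp (Pi.single s 1) (frobVec F m i) := by
  have h0 : ∀ f : S F m, pderiv s (f ^ Fintype.card F ^ i) = 0 := fun f =>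
    pderiv_pow_even s f (dvd_pow (two_dvd_card F) (by omega))
  simp only [xi, symp, frobVec, x, y, map_sum, map_add, pderiv_mul, h0, mul_zero, add_zero,
    pderiv_X]

theorem pderiv_pf {I : Finset ℕ} (hI : 0 ∉ I) (s : Fin m ⊕ Fin m) :
    pderiv s (pf (gram F m) I) = 0 := by
  have : I = (I.image (· - 1)).map (addRightEmbedding 1) := by
    ext a
    simp only [Finset.mem_map, Finset.mem_image, addRightEmbedding_apply, exists_exists_and_eq_and]
    have hpos : ∀ b ∈ I, b - 1 + 1 = b := fun b hb =>
      Nat.sub_add_cancel (Nat.pos_of_ne_zero fun h => hI (h ▸ hb))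
    exact ⟨fun ha => ⟨a, ha, hpos a ha⟩, fun ⟨b, hb, hba⟩ => by rwa [← hba, hpos b hb]⟩
  rw [this, pf_gram_map_add, pow_one]
  exact pderiv_pow_even _ _ (two_dvd_card F)

theorem pderiv_pf_insert {I : Finset ℕ} (hI : 0 ∉ I) (s : Fin m ⊕ Fin m) :
    pderiv s (pf (gram F m) (insert 0 I)) = pfFun (frobVec F m) I (Pi.single s 1) := by
  rw [pf_insert gram_comm hI, map_sum, pfFun_apply]
  refine Finset.sum_congr rfl fun j hj => ?_
  have hj1 : 1 ≤ j := Nat.pos_of_ne_zero fun h => hI (h ▸ hj)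
  rw [pderiv_mul, pderiv_pf (fun h => hI (Finset.mem_of_mem_erase h)), mul_zero, add_zero,
    ← xi_eq_gram, pderiv_xi hj1]
  rfl

theorem sum_Icc_sum_Ico_add {R : Type*} [AddCommMonoid R] (n : ℕ) (g : ℕ → ℕ → R) :
    ∑ k ∈ Finset.Icc 1 n, ∑ j ∈ Finset.Ico 1 k, (g j k + g k j) =
      ∑ k ∈ Finset.Icc 1 n, ∑ j ∈ (Finset.Icc 1 n).erase k, g k j := by
  have h1 : ∀ k ∈ Finset.Icc 1 n, ∑ j ∈ (Finset.Icc 1 n).erase k, g k j =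
      ∑ j ∈ Finset.Ico 1 k, g k j + ∑ j ∈ Finset.Ioc k n, g k j := by
    intro k hk
    rw [Finset.mem_Icc] at hk
    rw [← Finset.sum_union]
    · congr 1
      ext j
      simp only [Finset.mem_erase, Finset.mem_union, Finset.mem_Icc, Finset.mem_Ico,
        Finset.mem_Ioc]
      omega
    · rw [Finset.disjoint_left]
      intro j
      simp only [Finset.mem_Ico, Finset.mem_Ioc]
      omega
  rw [Finset.sum_congr rfl h1]
  simp only [Finset.sum_add_distrib]
  rw [add_comm]
  congr 1
  refine Finset.sum_comm' fun a b => ?_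
  simp only [Finset.mem_Icc, Finset.mem_Ico, Finset.mem_Ioc]
  omega

end Derivatives

/-! ### The derivative of the Dickson invariant -/

section Derivatives

variable {F : Type*} [Field F] [Fintype F] {m : ℕ}

theorem pfFun_frobVec_notMem {I : Finset ℕ} {i : ℕ} (hi : i ∉ I) :
    pfFun (frobVec F m) I (frobVec F m i) = pf (gram F m) (insert i I) :=
  pfFun_notMem _ hi

theorem pfFun_frobVec (I : Finset ℕ) (ω : Fin m ⊕ Fin m → S F m) :
    pfFun (frobVec F m) I ω = ∑ j ∈ I, symp ω (frobVec F m j) * pf (gram F m) (I.erase j) := rfl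

variable [CharP F 2]

theorem delta1_eq_sum_pf (m : ℕ) :
    delta1 F m = ∑ k ∈ Finset.Icc 1 (2 * m - 2), ∑ j ∈ Finset.Ico 1 k,
      xi F m j * xi F m k * pf (gram F m) (((Finset.Icc 1 (2 * m - 2)).erase j).erase k) := by
  refine Finset.sum_congr rfl fun k hk => Finset.sum_congr rfl fun j hj => ?_
  simp only [Finset.mem_Icc, Finset.mem_Ico] at hk hj
  rw [delta_eq_pf]
  · simp only [Finset.mem_Icc]
    omega
  · simp only [Finset.mem_erase, Finset.mem_Icc]
    omega

/-- The Pfaffians `δ_{jk}` avoid the index `0` and behave as constants. Collecting the terms in the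
derivative of `ξ_k`, the sum over `j` is the expansion along `0` of a Pfaffian. -/
theorem pderiv_delta1 (m : ℕ) (s : Fin m ⊕ Fin m) :
    pderiv s (delta1 F m) = ∑ k ∈ Finset.Icc 1 (2 * m - 2),
      symp (Pi.single s 1) (frobVec F m k) *
        pf (gram F m) (insert 0 ((Finset.Icc 1 (2 * m - 2)).erase k)) := by
  generalize hI : Finset.Icc 1 (2 * m - 2) = I
  have h0I : 0 ∉ I := by simp [← hI]
  have h1 : ∀ k ∈ I, symp (Pi.single s 1) (frobVec F m k) *
      pf (gram F m) (insert 0 (I.erase k)) = ∑ j ∈ I.erase k,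
      symp (Pi.single s 1) (frobVec F m k) *
        (gram F m 0 j * pf (gram F m) ((I.erase k).erase j)) := by
    intro k _
    rw [pf_insert gram_comm (fun h => h0I (Finset.mem_of_mem_erase h)), Finset.mul_sum]
  have h2 : ∀ k ∈ I, ∀ j ∈ Finset.Ico 1 k,
      pderiv s (xi F m j * xi F m k * pf (gram F m) ((I.erase j).erase k)) =
      symp (Pi.single s 1) (frobVec F m j) *
        (gram F m 0 k * pf (gram F m) ((I.erase j).erase k)) +
      symp (Pi.single s 1) (frobVec F m k) *
        (gram F m 0 j * pf (gram F m) ((I.erase k).erase j)) := by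
    intro k hk j hj
    simp only [← hI, Finset.mem_Icc, Finset.mem_Ico] at hk hj
    rw [pderiv_mul, pderiv_pf (fun h => h0I (Finset.mem_of_mem_erase (Finset.mem_of_mem_erase h))),
      pderiv_mul, pderiv_xi hj.1, pderiv_xi hk.1, ← xi_eq_gram, ← xi_eq_gram,
      Finset.erase_right_comm (a := k) (b := j)]
    generalize pf (gram F m) ((I.erase j).erase k) = c
    ring
  rw [Finset.sum_congr rfl h1, delta1_eq_sum_pf, hI, map_sum]
  simp only [map_sum]
  rw [Finset.sum_congr rfl fun k hk => Finset.sum_congr rfl (h2 k hk), ← hI]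
  exact sum_Icc_sum_Ico_add _ _

/-- The derivative of `δ₁ + ξ̄₀ u_{m-1}^q`. -/
theorem pderiv_delta1_add (hm : 1 ≤ m) (s : Fin m ⊕ Fin m) :
    pderiv s (delta1 F m +
      xiBar0 F m * pf (gram F m) (Finset.range (2 * m - 2)) ^ Fintype.card F) =
      pfFun (frobVec F m) (Finset.range (2 * m - 1)) (Pi.single s 1) := by
  have h1 := pderiv_delta1 (F := F) m s
  have h2 : Finset.range (2 * m - 1) = insert 0 (Finset.Icc 1 (2 * m - 2)) := by
    ext j
    simp only [Finset.mem_range, Finset.mem_insert, Finset.mem_Icc]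
    omega
  -- The shifted Pfaffian is the cofactor of index `0`, so the term in `ξ̄₀` supplies the summand
  -- missing from `pderiv_delta1`.
  have h3 : pf (gram F m) (Finset.range (2 * m - 2)) ^ Fintype.card F =
      pf (gram F m) (Finset.Icc 1 (2 * m - 2)) := by
    rw [← pf_gram_Ico]
    rfl
  have h0 : 0 ∉ Finset.Icc 1 (2 * m - 2) := by simp
  rw [map_add, h3, pderiv_mul, pderiv_pf h0, mul_zero, add_zero, pderiv_xiBar0, h1,
    pfFun_frobVec, h2, Finset.sum_insert h0, Finset.erase_insert h0, add_comm]
  refine congrArg₂ _ rfl (Finset.sum_congr rfl fun k hk => ?_)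
  have hk0 : 0 ≠ k := fun h => h0 (h ▸ hk)
  rw [Finset.erase_insert_of_ne hk0]

/-- A linear relation between the functionals which differentiate `u_m` and its companions. -/
theorem pfFun_relation (hm : 1 ≤ m) :
    u F m • pfFun (frobVec F m) (insert (2 * m) (Finset.Ico 1 (2 * m - 1))) +
      pf (gram F m) (insert (2 * m) (Finset.range (2 * m - 1))) •
        pfFun (frobVec F m) (Finset.Ico 1 (2 * m)) +
      u F m ^ Fintype.card F • pfFun (frobVec F m) (Finset.range (2 * m - 1)) = 0 := by
  -- At `k = 0` the first two terms coincide and the third vanishes; at `k = 2m - 1` the first and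
  -- third coincide and the second vanishes; at every other `k` all three contain a repetition.
  refine eq_zero_of_frobVec _ fun k hk => ?_
  simp only [LinearMap.add_apply, LinearMap.smul_apply, smul_eq_mul]
  rcases Nat.eq_zero_or_pos k with rfl | hk0
  · have h1 : insert 0 (insert (2 * m) (Finset.Ico 1 (2 * m - 1))) =
        insert (2 * m) (Finset.range (2 * m - 1)) := by
      ext a
      simp only [Finset.mem_insert, Finset.mem_Ico, Finset.mem_range]
      omega
    have h2 : insert 0 (Finset.Ico 1 (2 * m)) = Finset.range (2 * m) := by
      ext a
      simp only [Finset.mem_insert, Finset.mem_Ico, Finset.mem_range]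
      omega
    have h3 : 0 ∉ insert (2 * m) (Finset.Ico 1 (2 * m - 1)) := by
      simp only [Finset.mem_insert, Finset.mem_Ico]
      omega
    rw [pfFun_frobVec_notMem h3, h1, pfFun_frobVec_notMem (by simp), h2,
      pfFun_mem _ (by rw [Finset.mem_range]; omega), mul_zero, add_zero, pf_gram_range, mul_comm]
    exact CharTwo.add_self_eq_zero _
  rw [pfFun_mem _ (I := Finset.Ico 1 (2 * m)) (by rw [Finset.mem_Ico]; omega), mul_zero, add_zero]
  by_cases hk1 : k = 2 * m - 1
  · have h1 : k ∉ insert (2 * m) (Finset.Ico 1 (2 * m - 1)) := by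
      simp only [Finset.mem_insert, Finset.mem_Ico]
      omega
    have h2 : insert k (insert (2 * m) (Finset.Ico 1 (2 * m - 1))) = Finset.Ico 1 (2 * m + 1) := by
      ext a
      simp only [Finset.mem_insert, Finset.mem_Ico]
      omega
    have h3 : insert k (Finset.range (2 * m - 1)) = Finset.range (2 * m) := by
      ext a
      simp only [Finset.mem_insert, Finset.mem_range]
      omega
    rw [pfFun_frobVec_notMem h1, h2, pfFun_frobVec_notMem (by simp [hk1]), h3, pf_gram_Ico,
      pf_gram_range, mul_comm]
    exact CharTwo.add_self_eq_zero _
  · have h1 : k ∈ insert (2 * m) (Finset.Ico 1 (2 * m - 1)) := by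
      simp only [Finset.mem_insert, Finset.mem_Ico]
      omega
    rw [pfFun_mem _ h1, pfFun_mem _ (by rw [Finset.mem_range]; omega), mul_zero, mul_zero,
      add_zero]

theorem pderiv_u (m : ℕ) (s : Fin m ⊕ Fin m) :
    pderiv s (u F m) = pfFun (frobVec F m) (Finset.Ico 1 (2 * m)) (Pi.single s 1) := by
  rcases Nat.eq_zero_or_pos m with rfl | hm
  · exact isEmptyElim s
  have h : insert 0 (Finset.Ico 1 (2 * m)) = Finset.range (2 * m) := by
    ext a
    simp only [Finset.mem_insert, Finset.mem_Ico, Finset.mem_range]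
    omega
  rw [← pf_gram_range, ← h, pderiv_pf_insert (by simp)]

/-- A quotient rule without division. -/
theorem derivation_cancel {R : Type*} [CommRing R] [IsDomain R] [CharP R 2] {d v v' d' dv dv' n : R}
    {q : ℕ} (hq : 2 ≤ q) (hv : v ≠ 0) (h : d * v = v') (hd : d' * v + d * dv = dv')
    (hr : v * dv' + v' * dv + v ^ q * n = 0) : d' = v ^ (q - 2) * n := by
  refine mul_left_cancel₀ (pow_ne_zero 2 hv) ?_
  have hpow : v ^ q = v ^ 2 * v ^ (q - 2) := by
    rw [← pow_add]
    congr 1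
    omega
  have h2 : d * v * dv + d * v * dv = 0 := CharTwo.add_self_eq_zero _
  have h3 : v ^ 2 * (v ^ (q - 2) * n) + v ^ 2 * (v ^ (q - 2) * n) = 0 :=
    CharTwo.add_self_eq_zero _
  rw [hpow, ← hd, ← h] at hr
  linear_combination hr - h2 - h3

/-- Differentiate `dickson_mul_u`; the numerator of the quotient rule is given by `pfFun_relation`.
-/
theorem pderiv_dickson (hm : 1 ≤ m) (s : Fin m ⊕ Fin m) :
    pderiv s (dickson F 1 m) = u F m ^ (Fintype.card F - 2) *
      pfFun (frobVec F m) (Finset.range (2 * m - 1)) (Pi.single s 1) := by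
  have h1 : insert 0 (insert (2 * m) (Finset.Ico 1 (2 * m - 1))) =
      insert (2 * m) (Finset.range (2 * m - 1)) := by
    ext a
    simp only [Finset.mem_insert, Finset.mem_Ico, Finset.mem_range]
    omega
  have h3 : 0 ∉ insert (2 * m) (Finset.Ico 1 (2 * m - 1)) := by
    simp only [Finset.mem_insert, Finset.mem_Ico]
    omega
  have hdu := dickson_mul_u (F := F) hm
  have hD := congrArg (pderiv s) hdu
  rw [← h1, pderiv_pf_insert h3, pderiv_mul, pderiv_u] at hD
  have hL := LinearMap.congr_fun (pfFun_relation (F := F) hm) (Pi.single s 1)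
  simp only [LinearMap.add_apply, LinearMap.smul_apply, smul_eq_mul, LinearMap.zero_apply] at hL
  exact derivation_cancel Fintype.one_lt_card (u_ne_zero m) hdu hD hL

/-- The right-hand side of the equation for `b₁` is a square. -/
theorem exists_isB1 (hm : 1 ≤ m) :
    ∃ b : S F m, IsB1 (pf (gram F m) (Finset.range (2 * m - 2))) b := by
  refine exists_sq_eq_of_pderiv_eq_zero _ fun s => ?_
  -- Since `q - 2` is even, `u_m^(q-2)` has zero derivative, and the two remaining terms are equal.
  rw [map_add, pderiv_mul, pderiv_delta1_add hm, pderiv_dickson hm,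
    pderiv_pow_even _ _ (Nat.dvd_sub (two_dvd_card F) dvd_rfl), zero_mul, zero_add]
  exact CharTwo.add_self_eq_zero _

end Derivatives

/-! ### Algebraic independence of the `ξ_i` -/

section Independence

theorem pderiv_aeval {R σ τ : Type*} [CommRing R] [Fintype τ] (g : τ → MvPolynomial σ R) (s : σ)
    (P : MvPolynomial τ R) :
    pderiv s (aeval g P) = ∑ k, aeval g (pderiv k P) * pderiv s (g k) := by
  classical
  induction P using MvPolynomial.induction_on with
  | C a => simp
  | add p q hp hq => simp only [map_add, hp, hq, add_mul, Finset.sum_add_distrib]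
  | mul_X p i hp =>
    simp only [map_mul, aeval_X, pderiv_mul, hp, map_add, add_mul, Finset.sum_add_distrib,
      Finset.sum_mul, pderiv_X]
    congr 1
    · exact Finset.sum_congr rfl fun _ _ => by ring
    · rw [Finset.sum_eq_single i]
      · simp
      · intro b _ hb
        simp [Pi.single_eq_of_ne hb.symm]
      · simp

theorem totalDegree_pderiv_le {R σ : Type*} [CommRing R] (i : σ) (P : MvPolynomial σ R) {n : ℕ}
    (h : P.totalDegree ≤ n + 1) : (pderiv i P).totalDegree ≤ n := by
  refine Finset.sup_le fun a ha => ?_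
  rw [mem_support_iff, coeff_pderiv] at ha
  have h1 := le_totalDegree (mem_support_iff.2 (left_ne_zero_of_mul ha))
  rw [Finsupp.sum_add_index' (fun _ => rfl) (fun _ _ _ => rfl), Finsupp.sum_single_index rfl] at h1
  omega

variable {F : Type*} [Field F] [Fintype F]

theorem eq_zero_of_symp_single {R : Type*} [CommRing R] {n : ℕ} {v : Fin n ⊕ Fin n → R}
    (h : ∀ s, symp (Pi.single s 1) v = 0) : v = 0 := by
  funext s
  rcases s with j | j
  · have := h (Sum.inr j)
    simpa [symp, Pi.single_apply] using this
  · have := h (Sum.inl j)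
    simpa [symp, Pi.single_apply] using this

/-- The Pfaffians are polynomials in the `ξ_i`, independent of `m`. -/
theorem exists_aeval_xi_eq_pf (n N : ℕ) (hN : n ≤ N + 1) : ∃ P : MvPolynomial (Fin N) F,
    ∀ m, aeval (fun k : Fin N => xi F m (k.1 + 1)) P = pf (gram F m) (Finset.range n) := by
  -- The variable of index `k` stands for `ξ_{k+1}`, whence the `- 1`. The default `0` is never used
  -- for distinct indices below `n`, and `max` and `min` make the bracket symmetric.
  let br : ℕ → ℕ → MvPolynomial (Fin N) F := fun a b =>
    if h : max a b - min a b - 1 < N then X ⟨_, h⟩ ^ Fintype.card F ^ min a b else 0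
  refine ⟨pf br (Finset.range n), fun m => ?_⟩
  rw [← AlgHom.coe_toRingHom, map_pf]
  refine pf_congr fun a ha b hb hab => ?_
  rw [Finset.mem_range] at ha hb
  have key : ∀ a b : ℕ, a < n → b < n → a < b →
      aeval (fun k : Fin N => xi F m (k.1 + 1)) (br a b) = gram F m a b := by
    intro a b ha hb h
    have h1 : max a b - min a b - 1 < N := by omega
    simp only [br, dif_pos h1, map_pow, aeval_X]
    rw [gram_eq_xi h, min_eq_left h.le, max_eq_right h.le, Nat.sub_add_cancel (by omega)]
  rw [AlgHom.coe_toRingHom]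
  rcases lt_or_gt_of_ne hab with h | h
  · exact key a b ha hb h
  · rw [gram_comm, ← key b a hb ha h]
    simp only [br, max_comm a b, min_comm a b]

variable [CharP F 2]

/-- The Jacobian of the `ξ_i` has full rank: their gradients correspond to `f_1, …, f_N`, which are
among the vectors `f_1, …, f_{2n}` with Pfaffian `u_n^q ≠ 0`. The functional `pfFun` on all indices
but one isolates one coefficient. -/
theorem eq_zero_of_sum_mul_pderiv_xi {n N : ℕ} (hN : N ≤ 2 * n) (c : Fin N → S F n)
    (h : ∀ s, ∑ k, c k * pderiv s (xi F n (k.1 + 1)) = 0) (k : Fin N) : c k = 0 := by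
  have hv : ∑ k, c k • frobVec F n (k.1 + 1) = 0 := by
    refine eq_zero_of_symp_single fun s => ?_
    rw [← h s, symp_comm]
    have hlin : ∀ t : Finset (Fin N), symp (∑ k ∈ t, c k • frobVec F n (k.1 + 1)) (Pi.single s 1) =
        ∑ k ∈ t, c k * pderiv s (xi F n (k.1 + 1)) := by
      intro t
      induction t using Finset.induction_on with
      | empty => simp [symp]
      | insert a t ha ih =>
        rw [Finset.sum_insert ha, Finset.sum_insert ha, symp_add_left, ih, symp_smul_left,
          pderiv_xi (by omega), symp_comm]
    exact hlin _
  have h1 := congrArg (pfFun (frobVec F n) ((Finset.Ico 1 (2 * n + 1)).erase (k.1 + 1))) hv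
  rw [map_zero, map_sum, Finset.sum_eq_single k] at h1
  · rw [map_smul, pfFun_frobVec_notMem (by simp), Finset.insert_erase, pf_gram_Ico, pf_gram_range,
      smul_eq_mul] at h1
    · exact (mul_eq_zero.1 h1).resolve_right (pow_ne_zero _ (u_ne_zero n))
    · rw [Finset.mem_Ico]
      omega
  · intro b _ hb
    rw [map_smul, pfFun_mem, smul_zero]
    rw [Finset.mem_erase, Finset.mem_Ico]
    have : b.1 ≠ k.1 := fun h => hb (Fin.ext h)
    omega
  · simp

/-- Jacobian criterion by descent on the degree: the partial derivatives of a relation are relations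
of smaller degree, hence zero; the relation is then a square, and its root is a relation of half the
degree. -/
theorem aeval_xi_eq_zero {n N : ℕ} (hN : N ≤ 2 * n) (P : MvPolynomial (Fin N) F)
    (h : aeval (fun k : Fin N => xi F n (k.1 + 1)) P = 0) : P = 0 := by
  induction hd : P.totalDegree using Nat.strong_induction_on generalizing P with
  | _ d ih =>
  rcases d with _ | d
  · rw [totalDegree_eq_zero_iff_eq_C] at hd
    rw [hd, aeval_C, MvPolynomial.algebraMap_eq, C_eq_zero] at h
    rw [hd, h, C_0]
  have hpd : ∀ k, pderiv k P = 0 := fun k => by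
    refine ih _ (Nat.lt_succ_of_le (totalDegree_pderiv_le k P hd.le)) _ ?_ rfl
    refine eq_zero_of_sum_mul_pderiv_xi hN
      (fun k => aeval (fun k : Fin N => xi F n (k.1 + 1)) (pderiv k P)) (fun s => ?_) k
    rw [← pderiv_aeval, h, map_zero]
  obtain ⟨Q, rfl⟩ := exists_sq_eq_of_pderiv_eq_zero P hpd
  by_cases hQ : Q = 0
  · simp [hQ]
  rw [map_pow] at h
  rw [sq, totalDegree_mul_of_isDomain hQ hQ] at hd
  rw [ih _ (by omega) Q (by simpa using h) rfl]
  simp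

theorem isUPrev_iff (m : ℕ) (w : S F m) :
    IsUPrev F m w ↔ w = pf (gram F m) (Finset.range (2 * m - 2)) := by
  obtain ⟨P, hP⟩ := exists_aeval_xi_eq_pf (F := F) (2 * m - 2) (2 * m - 3) (by omega)
  have hP1 : aeval (fun k : Fin (2 * m - 3) => xi F (m - 1) (k.1 + 1)) P = u F (m - 1) := by
    rw [hP, ← pf_gram_range, show 2 * (m - 1) = 2 * m - 2 by omega]
  constructor
  · rintro ⟨Q, hQ, rfl⟩
    rw [← hP]
    have : Q - P = 0 := aeval_xi_eq_zero (n := m - 1) (by omega) _ (by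
      rw [map_sub, hQ, hP1, sub_self])
    rw [sub_eq_zero.1 this]
  · rintro rfl
    exact ⟨P, hP1, hP m⟩

end Independence

/-! ### Invariance -/

section Invariance

variable {F : Type*} [Field F] [Fintype F] {m : ℕ}

theorem pos_injective (m : ℕ) : Function.Injective (pos : Fin m ⊕ Fin m → Fin (2 * m + 1)) := by
  rintro (a | a) (b | b) h <;> simp only [pos, Fin.mk.injEq] at h <;>
    simp only [Sum.inl.injEq, Sum.inr.injEq, reduceCtorEq, Fin.ext_iff] <;> omega

theorem incl_injective (F : Type*) [Field F] (m : ℕ) : Function.Injective (incl F m) :=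
  rename_injective _ (pos_injective m)

variable (F) in
/-- The substitution of `v + v ^ q ^ i` for each variable `v`. -/
def substFrob (m i : ℕ) : Sz F m →ₐ[F] Sz F m := aeval fun j => X j + X j ^ Fintype.card F ^ i

/-- The entries of `g` lie in `F`, so its action commutes with the `q^i`-th power of the variables.
-/
theorem substFrob_act (i : ℕ) (g : GL (Fin (2 * m + 1)) F) (f : Sz F m) :
    substFrob F m i (act g f) = act g (substFrob F m i f) := by
  have : (substFrob F m i).comp (act g) = (act g).comp (substFrob F m i) := by
    ext1 j
    simp only [AlgHom.comp_apply, act, substFrob, aeval_X, map_sum, map_mul, map_add, map_pow,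
      algHom_C, MvPolynomial.algebraMap_eq]
    simp only [← frob_apply F (R := Sz F m), map_sum, map_mul]
    rw [← Finset.sum_add_distrib]
    refine Finset.sum_congr rfl fun k _ => ?_
    rw [← MvPolynomial.algebraMap_eq, AlgHom.commutes, mul_add]
  exact DFunLike.congr_fun this f

variable [CharP F 2]

/-- Polarization: `ξ_i` is the polar form of `ξ₀` at a vector and its Frobenius image, so it is
invariant along with `ξ₀`. -/
theorem substFrob_xi0 (m i : ℕ) : substFrob F m i (xi0 F m) =
    xi0 F m + xi0 F m ^ Fintype.card F ^ i + incl F m (xi F m i) := by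
  have h2 : ∀ a b : Sz F m, (a + b) ^ 2 = a ^ 2 + b ^ 2 := CharTwo.add_sq
  simp only [← frob_apply F (R := Sz F m), xi0, xiBar0, xi, incl, substFrob, map_add, map_pow,
    map_sum, map_mul, rename_X, aeval_X, x, y, h2]
  rw [add_assoc, add_assoc, add_assoc, add_assoc]
  congr 1
  rw [add_left_comm]
  congr 1
  rw [← Finset.sum_add_distrib, ← Finset.sum_add_distrib]
  refine Finset.sum_congr rfl fun j _ => ?_
  simp only [frob_apply]
  ring

theorem xi_invariant (m i : ℕ) : incl F m (xi F m i) ∈ invariantRing F m := by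
  intro g hg
  have h1 := substFrob_xi0 (F := F) m i
  have h2 := substFrob_act i g (xi0 F m)
  have hg : act g (xi0 F m) = xi0 F m := hg
  rw [hg, h1, map_add, map_add, map_pow, hg] at h2
  exact (add_left_cancel h2).symm

/-- The elements of `S` invariant under the orthogonal group. -/
def invS (F : Type*) [Field F] (m : ℕ) : Subalgebra F (S F m) := (invariantRing F m).comap (incl F m)

theorem mem_invS {F : Type*} [Field F] {m : ℕ} {f : S F m} : f ∈ invS F m ↔ incl F m f ∈ invariantRing F m := Iff.rfl

theorem pf_gram_mem_invS (m : ℕ) (I : Finset ℕ) : pf (gram F m) I ∈ invS F m :=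
  pf_mem _ fun _ _ _ _ hab => gram_mem _ (fun i _ => xi_invariant m i) hab

theorem u_mem_invS (m : ℕ) : u F m ∈ invS F m := pf_gram_range (F := F) m ▸ pf_gram_mem_invS m _

theorem delta1_mem_invS (m : ℕ) : delta1 F m ∈ invS F m := by
  rw [delta1_eq_sum_pf]
  exact sum_mem fun k _ => sum_mem fun j _ =>
    mul_mem (mul_mem (xi_invariant m j) (xi_invariant m k)) (pf_gram_mem_invS m _)

/-- A quotient of two invariants, the Pfaffian of `dickson_mul_u` by the nonzero `u_m`. -/
theorem dickson_mem_invS (hm : 1 ≤ m) : dickson F 1 m ∈ invS F m := by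
  intro g hg
  have h1 := pf_gram_mem_invS (F := F) m (insert (2 * m) (Finset.range (2 * m - 1))) g hg
  have h2 := u_mem_invS (F := F) m g hg
  rw [← dickson_mul_u hm, map_mul, map_mul] at h1
  have h3 : act g (incl F m (u F m)) = incl F m (u F m) := h2
  change act g (incl F m (dickson F 1 m)) * act g (incl F m (u F m)) = _ at h1
  rw [h3] at h1
  refine mul_right_cancel₀ ?_ h1
  exact fun h => u_ne_zero m (incl_injective F m (h.trans (map_zero _).symm))

/-- Squaring doubles the half exponents and completes `ξ̄₀` by `z²` to the invariant form `ξ₀`. -/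
theorem e1_sq {w b : S F m} (hb : IsB1 w b) :
    e1 w b ^ 2 = incl F m (dickson F 1 m) + incl F m (u F m) ^ (Fintype.card F - 2) *
      (incl F m (delta1 F m) + xi0 F m * incl F m w ^ Fintype.card F) := by
  have hb : b ^ 2 = _ := hb
  have hq := Nat.mul_div_cancel' (two_dvd_card F)
  rw [e1, CharTwo.add_sq, ← map_pow, hb, mul_pow, ← map_pow, mul_pow, ← pow_mul, ← pow_mul,
    Nat.sub_mul, mul_comm (Fintype.card F / 2) 2, hq, one_mul, xi0]
  simp only [map_add, map_mul, map_pow]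
  ring

theorem e1_mem_invariantRing (hm : 1 ≤ m) {w b : S F m} (hw : IsUPrev F m w) (hb : IsB1 w b) :
    e1 w b ∈ invariantRing F m := by
  have hwm : incl F m w ∈ invariantRing F m := by
    rw [(isUPrev_iff m w).1 hw]
    exact mem_invS.1 (pf_gram_mem_invS m _)
  have hxi0 : xi0 F m ∈ invariantRing F m := fun g hg => hg
  have h : e1 w b ^ 2 ∈ invariantRing F m := by
    rw [e1_sq hb]
    have h1 := mem_invS.1 (dickson_mem_invS (F := F) hm)
    have h2 := mem_invS.1 (u_mem_invS (F := F) m)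
    have h3 := mem_invS.1 (delta1_mem_invS (F := F) m)
    exact add_mem h1 (mul_mem (pow_mem h2 _) (add_mem h3 (mul_mem hxi0 (pow_mem hwm _))))
  intro g hg
  have := h g hg
  rw [map_pow] at this
  exact CharTwo.sq_injective this

end Invariance

/-! ### Homogeneity and leading terms -/

section Leading

/-- In characteristic two the coefficient of `2 • a` in `f ^ 2` is the square of that of `a` in `f`.
-/
theorem isHomogeneous_of_sq {F σ : Type*} [Field F] [CharP F 2] {f : MvPolynomial σ F} {n : ℕ}
    (h : (f ^ 2).IsHomogeneous (2 * n)) : f.IsHomogeneous n := by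
  intro a ha
  have h1 : coeff (2 • a) (f ^ 2) = coeff a f ^ 2 := by
    rw [← map_frobenius_expand 2, coeff_map, coeff_expand_smul _ two_ne_zero, frobenius_def]
  have h2 := h (d := 2 • a) (by rw [h1]; exact pow_ne_zero 2 ha)
  rw [map_nsmul, smul_eq_mul] at h2
  omega

theorem isHomogeneous_coeff_prod_X_sub_C {R σ ι : Type*} [CommRing R] (s : Finset ι)
    (l : ι → MvPolynomial σ R) (hl : ∀ i, (l i).IsHomogeneous 1) {n k : ℕ} (h : n + k = s.card) :
    ((∏ i ∈ s, (Polynomial.X - Polynomial.C (l i))).coeff k).IsHomogeneous n := by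
  classical
  induction s using Finset.induction_on generalizing n k with
  | empty =>
    obtain ⟨rfl, rfl⟩ : n = 0 ∧ k = 0 := by simpa using h
    simpa using isHomogeneous_one σ R
  | insert i s hi ih =>
    rw [Finset.card_insert_of_notMem hi] at h
    rw [Finset.prod_insert hi, mul_comm]
    have hbig : ∀ j, s.card < j →
        (∏ i ∈ s, (Polynomial.X - Polynomial.C (l i))).coeff j = 0 := by
      intro j hj
      refine Polynomial.coeff_eq_zero_of_natDegree_lt (lt_of_le_of_lt
        ((Polynomial.natDegree_prod_le _ _).trans (Finset.sum_le_card_nsmul _ _ 1 fun i _ =>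
          Polynomial.natDegree_X_sub_C_le _)) ?_)
      simpa using hj
    have hmul : ((∏ i ∈ s, (Polynomial.X - Polynomial.C (l i))).coeff k *
        l i).IsHomogeneous n := by
      rcases n with _ | n
      · rw [hbig k (by omega), zero_mul]
        exact isHomogeneous_zero _ _ _
      · exact (ih (by omega)).mul (hl i)
    rcases k with _ | k
    · rw [mul_sub, Polynomial.coeff_sub, Polynomial.coeff_mul_X_zero, zero_sub,
        Polynomial.coeff_mul_C]
      exact hmul.neg
    · rw [mul_sub, Polynomial.coeff_sub, Polynomial.coeff_mul_X, Polynomial.coeff_mul_C]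
      exact (ih (by omega)).sub hmul

theorem isHomogeneous_pf {R σ : Type*} [CommRing R] {br : ℕ → ℕ → MvPolynomial σ R} {d : ℕ → ℕ}
    (h : ∀ a b, (br a b).IsHomogeneous (d a + d b)) (I : Finset ℕ) :
    (pf br I).IsHomogeneous (∑ i ∈ I, d i) := by
  induction hn : I.card using Nat.strong_induction_on generalizing I with
  | _ n ih =>
  by_cases hI : I.Nonempty
  · rw [pf_min _ hI]
    refine IsHomogeneous.sum _ _ _ fun j hj => ?_
    rw [← Finset.add_sum_erase _ _ (I.min'_mem hI), ← Finset.add_sum_erase _ _ hj, ← add_assoc]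
    exact (h _ _).mul (ih _ (hn ▸ card_erase_erase_lt (I.min'_mem hI)) _ rfl)
  · rw [Finset.not_nonempty_iff_eq_empty.1 hI, pf_empty]
    exact isHomogeneous_one σ R

/-- In a homogeneous polynomial, the coefficient of a power of a variable is a value. -/
theorem coeff_single_eq_eval {R σ : Type*} [CommRing R] [DecidableEq σ] {f : MvPolynomial σ R}
    {n : ℕ} (hf : f.IsHomogeneous n) (i : σ) :
    coeff (Finsupp.single i n) f = eval (Pi.single i 1) f := by
  rw [eval_eq, Finset.sum_eq_single (Finsupp.single i n)]
  · rw [Finset.prod_eq_one, mul_one]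
    intro j hj
    have := Finsupp.support_single_subset hj
    rw [Finset.mem_singleton] at this
    rw [this, Pi.single_eq_same, one_pow]
  · intro a ha hne
    obtain ⟨j, hj, hji⟩ : ∃ j ∈ a.support, j ≠ i := by
      by_contra! hcon
      obtain ⟨c, rfl⟩ : ∃ c, a = Finsupp.single i c :=
        ⟨a i, Finsupp.support_subset_singleton.1 fun j hj => Finset.mem_singleton.2 (hcon j hj)⟩
      have hd := hf.degree_eq_sum_deg_support ha
      have : (Finsupp.single i c).degree = n := by
        rw [hd]
        rfl
      rw [Finsupp.degree_single] at this
      exact hne (by rw [this])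
    rw [Finset.prod_eq_zero hj, mul_zero]
    rw [Pi.single_eq_of_ne hji, zero_pow (Finsupp.mem_support_iff.1 hj)]
  · intro h
    rw [notMem_support_iff.1 h, zero_mul]

/-- The first conclusion serves the lexicographic order, the second the graded reverse lexicographic
one. -/
theorem exists_lt_of_degree_eq {k n : ℕ} {a : Fin (k + 1) →₀ ℕ} (ha : a.degree = n)
    (hne : a ≠ Finsupp.single 0 n) : a 0 < n ∧ ∃ i, 0 < a i ∧ i ≠ 0 ∧ ∀ j, i < j → a j = 0 := by
  have hex : ∃ i, 0 < a i ∧ i ≠ 0 := by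
    by_contra! hcon
    obtain ⟨c, rfl⟩ : ∃ c, a = Finsupp.single 0 c :=
      ⟨a 0, Finsupp.support_subset_singleton.1 fun j hj => Finset.mem_singleton.2
        (hcon j (Nat.pos_of_ne_zero (Finsupp.mem_support_iff.1 hj)))⟩
    rw [Finsupp.degree_single] at ha
    exact hne (by rw [ha])
  constructor
  · obtain ⟨i, hi, hi0⟩ := hex
    rw [Finsupp.degree_eq_sum, ← Finset.add_sum_erase _ _ (Finset.mem_univ 0)] at ha
    have : a i ≤ ∑ j ∈ Finset.univ.erase 0, a j :=
      Finset.single_le_sum (f := fun j => a j) (fun _ _ => Nat.zero_le _) (by simp [hi0])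
    omega
  · have hne' : (Finset.univ.filter fun i => 0 < a i ∧ i ≠ 0).Nonempty := by
      obtain ⟨i, hi⟩ := hex
      exact ⟨i, by simpa using hi⟩
    obtain ⟨i, hi, hmax⟩ := Finset.exists_max_image _ id hne'
    rw [Finset.mem_filter] at hi
    refine ⟨i, hi.2.1, hi.2.2, fun j hj => ?_⟩
    by_contra h0
    have := hmax j (by
      rw [Finset.mem_filter]
      exact ⟨Finset.mem_univ j, Nat.pos_of_ne_zero h0, (hj.trans_le' (Fin.zero_le _)).ne'⟩)
    exact absurd hj (not_lt.2 this)

theorem lex_leadingTerm_eq {R : Type*} [CommRing R] [Nontrivial R] {k n : ℕ}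
    {f : MvPolynomial (Fin (k + 1)) R} (hf : f.IsHomogeneous n)
    (hc : coeff (Finsupp.single 0 n) f = 1) : MonomialOrder.lex.leadingTerm f = X 0 ^ n := by
  have hmem : Finsupp.single 0 n ∈ f.support := by
    rw [mem_support_iff, hc]
    exact one_ne_zero
  have hdeg : MonomialOrder.lex.degree f = Finsupp.single 0 n := by
    apply MonomialOrder.lex.toSyn.injective
    refine le_antisymm (MonomialOrder.degree_le_iff.2 fun a ha => ?_)
      (MonomialOrder.le_degree hmem)
    by_cases hne : a = Finsupp.single 0 n
    · rw [hne]
    have hd : a.degree = n := (hf.degree_eq_sum_deg_support ha).symm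
    refine le_of_lt (MonomialOrder.lex_lt_iff.2 ⟨0, fun j hj => absurd hj (Fin.not_lt_zero j), ?_⟩)
    simpa using (exists_lt_of_degree_eq hd hne).1
  rw [MonomialOrder.leadingTerm, MonomialOrder.leadingCoeff, hdeg, hc, X_pow_eq_monomial]

theorem isGrevlexLeadingTerm_of_isHomogeneous {R : Type*} [CommRing R] [Nontrivial R] {k n : ℕ}
    {f : MvPolynomial (Fin (k + 1)) R} (hf : f.IsHomogeneous n)
    (hc : coeff (Finsupp.single 0 n) f = 1) : IsGrevlexLeadingTerm f (Finsupp.single 0 n) 1 := by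
  refine ⟨one_ne_zero, hc, fun a ha hne => Or.inr ?_⟩
  have hd : a.degree = n := (hf.degree_eq_sum_deg_support ha).symm
  obtain ⟨i, hi, hi0, hj⟩ := (exists_lt_of_degree_eq hd hne).2
  refine ⟨by rw [hd, Finsupp.degree_single], i, ?_, fun j hij => ?_⟩
  · rwa [Finsupp.single_eq_of_ne hi0]
  · rw [hj j hij, Finsupp.single_eq_of_ne (hij.trans_le' (Fin.zero_le _)).ne']

variable {F : Type*} [Field F] [Fintype F]

theorem isHomogeneous_gram (m a b : ℕ) :
    (gram F m a b).IsHomogeneous (Fintype.card F ^ a + Fintype.card F ^ b) :=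
  IsHomogeneous.sum _ _ _ fun _ _ =>
    ((isHomogeneous_X_pow _ _).mul (isHomogeneous_X_pow _ _)).add
      ((isHomogeneous_X_pow _ _).mul (isHomogeneous_X_pow _ _))

theorem isHomogeneous_pf_gram (m : ℕ) (I : Finset ℕ) :
    (pf (gram F m) I).IsHomogeneous (∑ i ∈ I, Fintype.card F ^ i) :=
  isHomogeneous_pf (isHomogeneous_gram m) I

theorem isHomogeneous_xi (m i : ℕ) : (xi F m i).IsHomogeneous (1 + Fintype.card F ^ i) := by
  rw [xi_eq_gram]
  simpa using isHomogeneous_gram (F := F) m 0 i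

theorem isHomogeneous_xi0 (F : Type*) [Field F] (m : ℕ) : (xi0 F m).IsHomogeneous 2 := by
  refine (isHomogeneous_X_pow _ _).add (IsHomogeneous.rename_isHomogeneous ?_)
  exact IsHomogeneous.sum _ _ _ fun j _ => (isHomogeneous_X _ _).mul (isHomogeneous_X _ _)

theorem isHomogeneous_dickson {m : ℕ} (hm : 1 ≤ m) : (dickson F 1 m).IsHomogeneous
    (Fintype.card F ^ (2 * m - 1) * (Fintype.card F - 1)) := by
  classical
  refine isHomogeneous_coeff_prod_X_sub_C _ _ (fun c => IsHomogeneous.sum _ _ _ fun v _ =>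
    isHomogeneous_C_mul_X _ _) ?_
  rw [Finset.filter_ne', Finset.card_erase_of_mem (Finset.mem_univ _), Finset.card_univ,
    Fintype.card_fun, Fintype.card_sum, Fintype.card_fin]
  obtain ⟨n, rfl⟩ : ∃ n, m = n + 1 := ⟨m - 1, by omega⟩
  have h2 : 0 < Fintype.card F ^ (2 * (n + 1) - 1) := pow_pos Fintype.card_pos _
  rw [show n + 1 + (n + 1) = 2 * (n + 1) - 1 + 1 by omega, pow_succ, Nat.mul_sub, mul_one]
  have h3 := Nat.le_mul_of_pos_right (Fintype.card F ^ (2 * (n + 1) - 1))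
    (Fintype.card_pos (α := F))
  omega

theorem eval_incl_y {F : Type*} [Field F] {m : ℕ} (hm : 1 ≤ m) (f : S F m) :
    eval (Pi.single (0 : Fin (2 * m + 1)) 1) (incl F m f) =
      eval (Pi.single (Sum.inl ⟨0, hm⟩) 1) f := by
  rw [incl, eval_rename]
  congr 2
  funext v
  have h0 : (0 : Fin (2 * m + 1)) = pos (Sum.inl (⟨0, hm⟩ : Fin m)) := rfl
  rw [Function.comp_apply, Pi.single_apply, Pi.single_apply, h0]
  exact if_congr (pos_injective m).eq_iff rfl rfl

theorem eval_xi {m : ℕ} (j₀ : Fin m) (i : ℕ) :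
    eval (Pi.single (Sum.inl j₀) 1) (xi F m i) = 0 := by
  simp [xi, x, y]

variable [CharP F 2]

theorem isHomogeneous_delta1 (m : ℕ) : (delta1 F m).IsHomogeneous
    (2 + ∑ i ∈ Finset.Icc 1 (2 * m - 2), Fintype.card F ^ i) := by
  rw [delta1_eq_sum_pf]
  refine IsHomogeneous.sum _ _ _ fun k hk => IsHomogeneous.sum _ _ _ fun j hj => ?_
  have hj' : j ∈ Finset.Icc 1 (2 * m - 2) := by
    simp only [Finset.mem_Icc, Finset.mem_Ico] at *
    omega
  have hk' : k ∈ (Finset.Icc 1 (2 * m - 2)).erase j := by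
    simp only [Finset.mem_erase, Finset.mem_Icc, Finset.mem_Ico] at *
    omega
  rw [← Finset.add_sum_erase _ _ hj', ← Finset.add_sum_erase _ _ hk']
  convert ((isHomogeneous_xi m j).mul (isHomogeneous_xi m k)).mul (isHomogeneous_pf_gram m _)
    using 1
  ring

theorem isHomogeneous_e1 {m : ℕ} (hm : 1 ≤ m) {w b : S F m} (hw : IsUPrev F m w)
    (hb : IsB1 w b) :
    (e1 w b).IsHomogeneous (Fintype.card F ^ (2 * m - 1) * (Fintype.card F - 1) / 2) := by
  have hq : 1 < Fintype.card F := Fintype.one_lt_card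
  apply isHomogeneous_of_sq
  rw [Nat.mul_div_cancel' ((dvd_pow (two_dvd_card F) (by omega)).mul_right _), e1_sq hb]
  have hwq : (w ^ Fintype.card F).IsHomogeneous
      (∑ i ∈ Finset.Icc 1 (2 * m - 2), Fintype.card F ^ i) := by
    rw [(isUPrev_iff m w).1 hw, ← pf_gram_Ico]
    exact isHomogeneous_pf_gram m _
  have hu : (u F m).IsHomogeneous (∑ i ∈ Finset.range (2 * m), Fintype.card F ^ i) := by
    rw [← pf_gram_range]
    exact isHomogeneous_pf_gram m _
  -- Both summands of `e₁²` have the same degree, by the geometric sum `(1 + q + ⋯ + q^{2m-2})(q -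
  -- 1) + 1 = q^{2m-1}`.
  have hdeg : (∑ i ∈ Finset.range (2 * m), Fintype.card F ^ i) * (Fintype.card F - 2) +
      (2 + ∑ i ∈ Finset.Icc 1 (2 * m - 2), Fintype.card F ^ i) =
      Fintype.card F ^ (2 * m - 1) * (Fintype.card F - 1) := by
    have h1 : insert 0 (Finset.Icc 1 (2 * m - 2)) = Finset.range (2 * m - 1) := by
      ext a
      simp only [Finset.mem_insert, Finset.mem_Icc, Finset.mem_range]
      omega
    have h2 : ∑ i ∈ Finset.range (2 * m - 1), Fintype.card F ^ i =
        1 + ∑ i ∈ Finset.Icc 1 (2 * m - 2), Fintype.card F ^ i := by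
      rw [← h1, Finset.sum_insert (by simp), pow_zero]
    have h3 : ∑ i ∈ Finset.range (2 * m), Fintype.card F ^ i =
        ∑ i ∈ Finset.range (2 * m - 1), Fintype.card F ^ i + Fintype.card F ^ (2 * m - 1) := by
      rw [← Finset.sum_range_succ, Nat.sub_add_cancel (by omega)]
    obtain ⟨r, hr⟩ : ∃ r, Fintype.card F = r + 2 := ⟨Fintype.card F - 2, by omega⟩
    have h4 : (∑ i ∈ Finset.range (2 * m - 1), Fintype.card F ^ i) * (r + 1) + 1 =
        Fintype.card F ^ (2 * m - 1) := by
      have := geom_sum_mul_add (r + 1) (2 * m - 1)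
      rw [hr]
      exact this
    rw [h3, show Fintype.card F - 2 = r by omega, show Fintype.card F - 1 = r + 1 by omega]
    linear_combination h4 - h2
  rw [← map_pow, ← map_pow]
  refine (isHomogeneous_dickson hm).rename_isHomogeneous.add ?_
  rw [← hdeg]
  exact (hu.pow _).rename_isHomogeneous.mul ((isHomogeneous_delta1 m).rename_isHomogeneous.add
    ((isHomogeneous_xi0 F m).mul hwq.rename_isHomogeneous))

/-- At this point a linear form specialises to one of its coefficients, so the product of all `t -
v`, zero form included, becomes `(t^q - t)^{q^{2m-1}} = t^{q^{2m}} + t^{q^{2m-1}}`. -/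
theorem eval_dickson {m : ℕ} (j₀ : Fin m) :
    eval (Pi.single (Sum.inl j₀) 1) (dickson F 1 m) = 1 := by
  classical
  have hq : 1 < Fintype.card F := Fintype.one_lt_card
  have hpos : 0 < Fintype.card F ^ (2 * m - 1) := pow_pos (by omega) _
  have h1 : (Polynomial.X * dicksonPoly F m).map (eval (Pi.single (Sum.inl j₀) 1)) =
      ∏ c : Fin m ⊕ Fin m → F, (Polynomial.X - Polynomial.C (c (Sum.inl j₀))) := by
    rw [← Finset.mul_prod_erase _ _ (Finset.mem_univ 0), dicksonPoly, Finset.filter_ne']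
    simp only [Polynomial.map_mul, Polynomial.map_X, Polynomial.map_prod, Polynomial.map_sub,
      Polynomial.map_C]
    simp only [map_sum, map_mul, eval_C, eval_X, Pi.single_apply, mul_ite, mul_one,
      mul_zero, Finset.sum_ite_eq', Finset.mem_univ, if_true, Pi.zero_apply, map_zero, sub_zero]
  have h2 : ∏ c : Fin m ⊕ Fin m → F, (Polynomial.X - Polynomial.C (c (Sum.inl j₀))) =
      (Polynomial.X ^ Fintype.card F - Polynomial.X) ^ Fintype.card F ^ (2 * m - 1) := by
    have h3 := prod_add_algebraMap_mul F (Polynomial.X : Polynomial F) 1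
    rw [one_pow, one_mul] at h3
    rw [← Equiv.prod_comp (Equiv.funSplitAt (Sum.inl j₀) F).symm, Fintype.prod_prod_type]
    rw [← h3, ← Finset.prod_pow]
    refine Finset.prod_congr rfl fun c _ => ?_
    have hcard : Fintype.card ({j : Fin m ⊕ Fin m // j ≠ Sum.inl j₀} → F) =
        Fintype.card F ^ (2 * m - 1) := by
      rw [Fintype.card_fun, Fintype.card_subtype_compl, Fintype.card_sum, Fintype.card_fin]
      simp [two_mul]
    rw [← hcard, ← Finset.card_univ, ← Finset.prod_const]
    refine Finset.prod_congr rfl fun d _ => ?_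
    rw [CharTwo.sub_eq_add]
    simp [Equiv.funSplitAt, Equiv.piSplitAt]
  have h4 := congrArg (fun p => Polynomial.coeff p (Fintype.card F ^ (2 * m - 1))) (h1.trans h2)
  simp only [Polynomial.coeff_map] at h4
  rw [← Nat.sub_add_cancel (Nat.succ_le_of_lt hpos), Polynomial.coeff_X_mul,
    Nat.sub_add_cancel (Nat.succ_le_of_lt hpos), CharTwo.sub_eq_add, ← frob_apply F, map_add,
    frob_apply, frob_apply, Polynomial.coeff_add, ← pow_mul, Polynomial.coeff_X_pow,
    Polynomial.coeff_X_pow, if_pos rfl, if_neg, zero_add] at h4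
  · exact h4
  · intro h
    have : Fintype.card F ^ (2 * m - 1) * 1 < Fintype.card F ^ (2 * m - 1) * Fintype.card F :=
      Nat.mul_lt_mul_of_pos_left hq hpos
    rw [mul_one, mul_comm _ (Fintype.card F)] at this
    omega

/-- In `e1_sq` the `ξ_i` and `ξ₀` vanish at this point, which leaves the Dickson invariant. -/
theorem eval_e1 {m : ℕ} (hm : 1 ≤ m) {w b : S F m} (hb : IsB1 w b) :
    eval (Pi.single (0 : Fin (2 * m + 1)) 1) (e1 w b) = 1 := by
  have h1 := congrArg (eval (Pi.single (0 : Fin (2 * m + 1)) (1 : F))) (e1_sq hb)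
  have hz : (0 : Fin (2 * m + 1)) ≠ zpos m := by
    simp only [zpos, ne_eq, Fin.ext_iff, Fin.val_zero]
    omega
  have hdelta : eval (Pi.single (Sum.inl ⟨0, hm⟩) 1) (delta1 F m) = 0 := by
    simp only [delta1, map_sum, map_mul, eval_xi, zero_mul, Finset.sum_const_zero]
  have hxi0 : eval (Pi.single (0 : Fin (2 * m + 1)) 1) (xi0 F m) = 0 := by
    rw [xi0, map_add, map_pow, eval_X, Pi.single_eq_of_ne hz.symm, eval_incl_y hm]
    simp [xiBar0, x, y]
  rw [map_pow, map_add, map_mul, map_add, map_mul, hxi0, eval_incl_y hm, eval_incl_y hm, hdelta,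
    eval_dickson, zero_mul, add_zero, mul_zero, add_zero] at h1
  exact CharTwo.sq_injective (h1.trans (one_pow 2).symm)

end Leading

end OddOrth

end

/-! ### The main theorem -/

theorem mainTheorem6 (F : Type*) [Field F] [Fintype F] [CharP F 2] (m : ℕ) (hm : 1 ≤ m) :
    (∃! w : OddOrth.S F m, OddOrth.IsUPrev F m w) ∧
    ∀ w : OddOrth.S F m, OddOrth.IsUPrev F m w →
      (∃! b : OddOrth.S F m, OddOrth.IsB1 w b) ∧
      ∀ b : OddOrth.S F m, OddOrth.IsB1 w b →
        OddOrth.e1 w b ∈ OddOrth.invariantRing F m ∧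
        MonomialOrder.lex.leadingTerm (OddOrth.e1 w b) =
          MvPolynomial.X (0 : Fin (2 * m + 1)) ^
            (Fintype.card F ^ (2 * m - 1) * (Fintype.card F - 1) / 2) ∧
        IsGrevlexLeadingTerm (OddOrth.e1 w b)
          (Finsupp.single (0 : Fin (2 * m + 1))
            (Fintype.card F ^ (2 * m - 1) * (Fintype.card F - 1) / 2)) 1 := by
  refine ⟨⟨_, (OddOrth.isUPrev_iff m _).2 rfl, fun w hw => (OddOrth.isUPrev_iff m w).1 hw⟩,
    fun w hw => ⟨?_, fun b hb => ?_⟩⟩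
  · obtain ⟨b, hb⟩ := OddOrth.exists_isB1 (F := F) hm
    rw [← (OddOrth.isUPrev_iff m w).1 hw] at hb
    exact ⟨b, hb, fun b' hb' => CharTwo.sq_injective (Eq.trans hb' (Eq.symm hb))⟩
  · have hhom := OddOrth.isHomogeneous_e1 hm hw hb
    have hc := (OddOrth.coeff_single_eq_eval hhom 0).trans (OddOrth.eval_e1 hm hb)
    exact ⟨OddOrth.e1_mem_invariantRing hm hw hb, OddOrth.lex_leadingTerm_eq hhom hc,
      OddOrth.isGrevlexLeadingTerm_of_isHomogeneous hhom hc⟩
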